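/- Consider a discrete-time single-input single-output linear time-invariant system with real impulse response $g\in\ell_1(\mathbb Z_{\ge 0})$, $g(0)=0$, and rational transfer function $G(z)=\sum_{t\ge 0} g(t)z^{-t}$ ($|z|\ge 1$), written in lowest terms. For a finite or one-sided infinite real sequence $u$, let $\mathrm{var}(u)\in\{0,1,\dots,\infty\}$ be the number of sign changes of $u$ after deletion of its zeros. A linear map $X$ is $\mathrm{OVD}_k$ if for every $u$ in its domain with $\mathrm{var}(u)\le k$ one has $\mathrm{var}(Xu)\le\mathrm{var}(u)$ and, whenever $\mathrm{var}(Xu)=\mathrm{var}(u)$ and $u,Xu\neq 0$, the first nonzero entries of $u$ and $Xu$ have the same sign. The system $G$ is *Hankel totally positive* if the Hankel operator $(\mathcal H_g u)(t)=\sum_{\tau\ge 1} g(t+\tau)\,u(-\tau)$, $t\ge 0$, acting on bounded past inputs listed as $(u(-1),u(-2),\dots)$, is $\mathrm{OVD}_{k-1}$ for every $k\ge 1$. A triple $(A,b,c)$ with $A\in\mathbb R^{n\times n}$ and $b,c^{\mathsf T}\in\mathbb R^n$ is a *realization* of $G$ if all eigenvalues of $A$ lie in the open unit disc and $x(t+1)=Ax(t)+bu(t)$,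 $y(t)=cx(t)$ has impulse response $g$; it is *minimal* if the eigenvalues of $A$ are precisely the poles of $G$, counted with multiplicity. It is *internally Hankel totally positive* if, for every $k\ge 1$, the maps $x\mapsto Ax$ on $\mathbb R^n$, $\mathcal C(A,b):u\mapsto\sum_{t\le -1}A^{-t-1}b\,u(t)$ on bounded past inputs listed as $(u(-1),u(-2),\dots)$, and $\mathcal O(A,c):x_0\mapsto (cA^tx_0)_{t\ge 0}$ on $\mathbb R^n$ are all $\mathrm{OVD}_{k-1}$. **Proposition.** $G$ is Hankel totally positive if and only if there exists a minimal realization of $G$ that is internally Hankel totally positive. Moreover, if $G$ is Hankel totally positive, then $G(z)=\sum_{i=1}^n \frac{r_i}{z-p_i}$ for some $n\ge 0$, $0\le p_1<\dots<p_n$ and $r_1,\dots,r_n>0$, and $A=\mathrm{diag}(p_1,\dots,p_n)$, $b=c^{\mathsf T}=(\sqrt{r_1},\dots,\sqrt{r_n})^{\mathsf T}$ is a minimal realization of $G$ that is internally Hankel totally positive. -/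

import Mathlib

open scoped Matrix

noncomputable section

namespace HankelTP

/-! ### Variation and order-preserving variation diminishing maps -/

/-- The number of sign changes of a finite (`ι = Fin n`) or infinite (`ι = ℕ`) real sequence after
all its zeros have been deleted: the number of pairs of entries of opposite sign that are
separated by zeros only. It may be infinite. -/
def variation {ι : Type*} [LinearOrder ι] (u : ι → ℝ) : ℕ∞ :=
  Set.encard {p : ι × ι | p.1 < p.2 ∧ u p.1 * u p.2 < 0 ∧ ∀ l, p.1 < l → l < p.2 → u l = 0}

/-- `i` is the position of the first nonzero entry of `u`. -/
def IsFirstNonzero {ι : Type*} [LinearOrder ι] (u : ι → ℝ) (i : ι) : Prop :=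
  u i ≠ 0 ∧ ∀ l < i, u l = 0

/-- The first nonzero entries of `u` and `v` have the same sign. There is nothing to compare if
one of the two sequences vanishes identically. -/
def SameFirstSign {ι κ : Type*} [LinearOrder ι] [LinearOrder κ] (u : ι → ℝ) (v : κ → ℝ) : Prop :=
  ∀ i j, IsFirstNonzero u i → IsFirstNonzero v j → SignType.sign (u i) = SignType.sign (v j)

/-- The map `u ↦ X u`, with domain `D`, is order-preserving `k`-variation diminishing. -/
def IsOVD {ι κ : Type*} [LinearOrder ι] [LinearOrder κ] (k : ℕ) (D : Set (ι → ℝ))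
    (X : (ι → ℝ) → (κ → ℝ)) : Prop :=
  ∀ u ∈ D, variation u ≤ k →
    variation (X u) ≤ variation u ∧ (variation (X u) = variation u → SameFirstSign u (X u))

/-- The bounded sequences. -/
def boundedSeq : Set (ℕ → ℝ) := {u | ∃ M : ℝ, ∀ s, |u s| ≤ M}

/-! ### Systems and their transfer functions -/

/-- The rational function `G`, written in lowest terms, is the transfer function
`G(z) = ∑ g(t) z⁻ᵗ` of the (absolutely summable) impulse response `g`. -/
def IsTransferFunction (g : ℕ → ℝ) (G : RatFunc ℝ) : Prop :=
  ∀ z : ℂ, 1 ≤ ‖z‖ → Polynomial.aeval z G.denom ≠ 0 ∧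
    HasSum (fun t : ℕ => (g t : ℂ) * (z ^ t)⁻¹) (RatFunc.eval (algebraMap ℝ ℂ) z G)

/-- The complex poles of `G`, with multiplicity. -/
def poles (G : RatFunc ℝ) : Multiset ℂ := G.denom.aroots ℂ

/-- The Hankel operator of `g`: `(H_g u)(t) = ∑_{τ ≥ 1} g(t + τ) u(-τ)` for `t ≥ 0`. Past inputs
are listed backwards from time `-1`: the entry `u s` is the input at time `-(s + 1)`. -/
def hankelOp (g : ℕ → ℝ) (u : ℕ → ℝ) : ℕ → ℝ := fun t => ∑' s : ℕ, g (t + (s + 1)) * u s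

/-- The system with impulse response `g` is Hankel `k`-positive (`k ≥ 1`). -/
def IsHankelPositive (k : ℕ) (g : ℕ → ℝ) : Prop := IsOVD (k - 1) boundedSeq (hankelOp g)

/-- The system with impulse response `g` is Hankel totally positive. -/
def IsHankelTotallyPositive (g : ℕ → ℝ) : Prop := ∀ k, 1 ≤ k → IsHankelPositive k g

/-! ### State-space realizations -/

variable {n : ℕ}

/-- The states of `x(t + 1) = A x(t) + b u(t)`, `x(0) = x₀`. -/
def state (A : Matrix (Fin n) (Fin n) ℝ) (b x₀ : Fin n → ℝ) (u : ℕ → ℝ) : ℕ → (Fin n → ℝ)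
  | 0 => x₀
  | t + 1 => A *ᵥ state A b x₀ u t + u t • b

/-- The impulse response of `x(t + 1) = A x(t) + b u(t)`, `y(t) = c x(t)`: the output that
corresponds to the unit pulse at time `0` and to the initial state `0`. -/
def impulseResponse (A : Matrix (Fin n) (Fin n) ℝ) (b c : Fin n → ℝ) : ℕ → ℝ :=
  fun t => c ⬝ᵥ state A b 0 (Pi.single 0 1) t

/-- The complex eigenvalues of `A`, with multiplicity. -/
def eigenvalues (A : Matrix (Fin n) (Fin n) ℝ) : Multiset ℂ := A.charpoly.aroots ℂ

/-- `A` is stable (in discrete time). -/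
def IsStable (A : Matrix (Fin n) (Fin n) ℝ) : Prop := ∀ μ ∈ eigenvalues A, ‖μ‖ < 1

/-- `(A, b, c)` is a realization of the system with impulse response `g`. -/
def IsRealization (g : ℕ → ℝ) (A : Matrix (Fin n) (Fin n) ℝ) (b c : Fin n → ℝ) : Prop :=
  IsStable A ∧ impulseResponse A b c = g

/-- `(A, b, c)` is a minimal realization of the system with impulse response `g` and transfer
function `G`: the eigenvalues of `A` are precisely the poles of `G`. -/
def IsMinimalRealization (g : ℕ → ℝ) (G : RatFunc ℝ) (A : Matrix (Fin n) (Fin n) ℝ)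
    (b c : Fin n → ℝ) : Prop :=
  IsRealization g A b c ∧ eigenvalues A = poles G

/-- The controllability operator `u ↦ ∑_{t ≤ -1} A^(-t-1) b u(t)`, where again the entry `u s` is
the input at time `-(s + 1)`. -/
def controllabilityOp (A : Matrix (Fin n) (Fin n) ℝ) (b : Fin n → ℝ) (u : ℕ → ℝ) : Fin n → ℝ :=
  ∑' s : ℕ, u s • ((A ^ s) *ᵥ b)

/-- The observability operator `x₀ ↦ (c Aᵗ x₀)_{t ≥ 0}`. -/
def observabilityOp (A : Matrix (Fin n) (Fin n) ℝ) (c : Fin n → ℝ) (x₀ : Fin n → ℝ) : ℕ → ℝ :=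
  fun t => c ⬝ᵥ ((A ^ t) *ᵥ x₀)

/-- `(A, b, c)` is internally Hankel `k`-positive (`k ≥ 1`). -/
def IsInternallyHankelPositive (k : ℕ) (A : Matrix (Fin n) (Fin n) ℝ) (b c : Fin n → ℝ) : Prop :=
  IsOVD (k - 1) Set.univ (fun x => A *ᵥ x) ∧
  IsOVD (k - 1) boundedSeq (controllabilityOp A b) ∧
  IsOVD (k - 1) Set.univ (observabilityOp A c)

/-- `(A, b, c)` is internally Hankel totally positive. -/
def IsInternallyHankelTotallyPositive (A : Matrix (Fin n) (Fin n) ℝ) (b c : Fin n → ℝ) : Prop :=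
  ∀ k, 1 ≤ k → IsInternallyHankelPositive k A b c

end HankelTP

end

open scoped Matrix

noncomputable section

namespace HankelTP

open Polynomial Filter Topology

/-! The Hankel operator is the controllability operator followed by the observability operator, and
order-preserving variation diminishing maps compose. So an internally Hankel totally positive
realization makes the system Hankel totally positive (`IsRealization.isHankelTotallyPositive`).

For the converse, an eigenvector of a finite Hankel matrix with negative eigenvalue, used as input,
would have all its signs reversed without loss of variation
(`IsHankelTotallyPositive.eigenvalue_nonneg`). Hence the functional `L` with `L (X ^ t) = g (t + 1)`
satisfies `L (q * q) ≥ 0` and `L (X * (q * q)) ≥ 0`. Rationality supplies a nonzero polynomial, the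
denominator of `G`, whose multiples `L` kills (`IsTransferFunction.denom_mem`). A nonnegative
functional of this kind is a finite positive combination of evaluations at nonnegative points
(`exists_atoms`), so `g (t + 1) = ∑ r i * p i ^ t`. Summability forces `p i < 1`, and partial
fractions and the diagonal realization follow.

For the diagonal realization, the controllability operator evaluates the power series with
coefficients `u` at the `p i`, up to positive factors, and the observability operator forms
exponential sums with bases `p i`. Both obey a Descartes rule of signs (`altFrom_of_powerSum`,
`altFrom_of_expSum`), proved by removing one sign change at a time. Alternating chains that record
their initial sign control variation and order together (`isOVD_of_altFrom`). -/

/-! ### Alternating chains of entries -/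

/-- There are indices `i = i₀ < ⋯ < iₖ` at which the entries of `u` alternate in sign, beginning
with the sign of `σ`. -/
def AltFrom {ι : Type*} [LinearOrder ι] (u : ι → ℝ) : ℕ → ℝ → ι → Prop
  | 0, σ, i => 0 < σ * u i
  | k + 1, σ, i => 0 < σ * u i ∧ ∃ j, i < j ∧ AltFrom u k (-σ) j

section Chains

variable {ι κ : Type*} [LinearOrder ι] [LinearOrder κ]

theorem AltFrom.pos {u : ι → ℝ} {k : ℕ} {σ : ℝ} {i : ι} (h : AltFrom u k σ i) :
    0 < σ * u i := by
  cases k with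
  | zero => exact h
  | succ k => exact h.1

theorem AltFrom.ne_zero {u : ι → ℝ} {k : ℕ} {σ : ℝ} {i : ι} (h : AltFrom u k σ i) :
    u i ≠ 0 := by
  intro h0
  have := h.pos
  simp [h0] at this

theorem AltFrom.mono {u : ι → ℝ} {k l : ℕ} {σ : ℝ} {i : ι} (hkl : k ≤ l)
    (h : AltFrom u l σ i) : AltFrom u k σ i := by
  induction k generalizing l σ i with
  | zero => exact h.pos
  | succ k ih =>
    obtain ⟨m, rfl⟩ : ∃ m, l = m + 1 := ⟨l - 1, by omega⟩
    obtain ⟨h1, j, hj, h2⟩ := h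
    exact ⟨h1, j, hj, ih (by omega) h2⟩

theorem pos_of_mul_pos_of_mul_pos {ε σ x y : ℝ} (h : 0 < ε * (x * y)) (hx : 0 < σ * x) :
    0 < ε * σ * y := by
  have hx0 : 0 < x ^ 2 := by
    have : x ≠ 0 := by rintro rfl; simp at hx
    positivity
  have h1 : 0 < (ε * σ * y) * x ^ 2 := by
    have := mul_pos h hx
    calc 0 < ε * (x * y) * (σ * x) := this
      _ = _ := by ring
  exact pos_of_mul_pos_left h1 hx0.le

/-- Chains are transported along maps that are increasing on the support and that multiply all
signs by that of `ε`. -/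
theorem AltFrom.map {u : ι → ℝ} {v : κ → ℝ} (φ : ι → κ) {ε : ℝ} {k : ℕ} {σ : ℝ} {i : ι}
    (hφ : ∀ a b, i ≤ a → u a ≠ 0 → u b ≠ 0 → a < b → φ a < φ b)
    (hs : ∀ a, i ≤ a → u a ≠ 0 → 0 < ε * (u a * v (φ a)))
    (h : AltFrom u k σ i) : AltFrom v k (ε * σ) (φ i) := by
  induction k generalizing σ i with
  | zero => exact pos_of_mul_pos_of_mul_pos (hs i le_rfl h.ne_zero) h
  | succ k ih =>
    have h0 := h.ne_zero
    obtain ⟨h1, j, hij, h2⟩ := h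
    refine ⟨pos_of_mul_pos_of_mul_pos (hs i le_rfl h0) h1, φ j,
      hφ i j le_rfl h0 h2.ne_zero hij, ?_⟩
    have := ih (fun a b ha => hφ a b (hij.le.trans ha)) (fun a ha => hs a (hij.le.trans ha)) h2
    rwa [mul_neg] at this

theorem AltFrom.congr_sign {u v : ι → ℝ} {k : ℕ} {σ : ℝ} {i : ι}
    (hs : ∀ a, i ≤ a → u a ≠ 0 → 0 < u a * v a) (h : AltFrom u k σ i) : AltFrom v k σ i := by
  have := h.map (v := v) (ε := 1) id (fun a b _ _ _ h => h)
    (fun a ha h0 => by simpa using hs a ha h0)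
  simpa using this

theorem AltFrom.congr_sign_neg {u v : ι → ℝ} {k : ℕ} {σ : ℝ} {i : ι}
    (hs : ∀ a, i ≤ a → u a ≠ 0 → u a * v a < 0) (h : AltFrom u k σ i) : AltFrom v k (-σ) i := by
  have := h.map (v := v) (ε := -1) id (fun a b _ _ _ h => h)
    (fun a ha h0 => by simpa using hs a ha h0)
  simpa using this

end Chains

/-! ### Chains and the variation -/

/-- The pairs of consecutive nonzero entries with opposite signs that are not before `i`. -/
def signChangesFrom {ι : Type*} [LinearOrder ι] (u : ι → ℝ) (i : ι) : Set (ι × ι) :=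
  {p | i ≤ p.1 ∧ p.1 < p.2 ∧ u p.1 * u p.2 < 0 ∧ ∀ l, p.1 < l → l < p.2 → u l = 0}

/-- Take `q` to be the first index after `a` whose entry has sign opposite to `u a`, and `p` the
last nonzero position before `q`; by minimality of `q`, `u p` still has the sign of `u a`. -/
theorem exists_signChange_between {ι : Type*} [LinearOrder ι] [LocallyFiniteOrder ι]
    {u : ι → ℝ} {a b : ι} (hab : a < b) (h : u a * u b < 0) :
    ∃ p q, a ≤ p ∧ p < q ∧ q ≤ b ∧ u p * u q < 0 ∧ ∀ l, p < l → l < q → u l = 0 := by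
  classical
  let Q := (Finset.Ioc a b).filter (fun x => u a * u x < 0)
  have hQ : Q.Nonempty := ⟨b, by simp [Q, hab, h]⟩
  have hq := Q.min'_mem hQ
  have hqmin := fun x hx => Q.min'_le x hx
  set q := Q.min' hQ
  simp only [Q, Finset.mem_filter, Finset.mem_Ioc] at hq hqmin
  have hua : u a ≠ 0 := by intro h0; simp [h0] at h
  let P := (Finset.Ico a q).filter (fun x => u x ≠ 0)
  have hP : P.Nonempty := ⟨a, by simp [P, hq.1.1, hua]⟩
  have hp := P.max'_mem hP
  have hpmax := fun x hx => P.le_max' x hx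
  set p := P.max' hP
  simp only [P, Finset.mem_filter, Finset.mem_Ico] at hp hpmax
  have hnp : ¬ u a * u p < 0 := by
    intro hlt
    rcases hp.1.1.eq_or_lt with he | hl
    · rw [← he] at hlt; nlinarith
    · exact absurd (hqmin p ⟨⟨hl, hp.1.2.le.trans hq.1.2⟩, hlt⟩) (not_le.2 hp.1.2)
  have hpos : 0 < u a * u p := lt_of_le_of_ne (not_lt.1 hnp) (mul_ne_zero hua hp.2).symm
  refine ⟨p, q, hp.1.1, hp.1.2, hq.1.2, ?_, ?_⟩
  · have h1 : (u a * u p) * (u a * u q) < 0 := mul_neg_of_pos_of_neg hpos hq.2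
    have h2 : 0 < u a ^ 2 := by positivity
    by_contra h3
    push Not at h3
    nlinarith [mul_nonneg h2.le h3]
  · intro l hl1 hl2
    by_contra h0
    exact absurd (hpmax l ⟨⟨hp.1.1.trans hl1.le, hl2⟩, h0⟩) (not_le.2 hl1)

/-- Each link `i < j` of the chain contains a consecutive sign change that starts before `j`, hence
is not among those counted from `j` on. -/
theorem AltFrom.le_encard {ι : Type*} [LinearOrder ι] [LocallyFiniteOrder ι]
    {u : ι → ℝ} {k : ℕ} {σ : ℝ} {i : ι} (h : AltFrom u k σ i) :
    (k : ℕ∞) ≤ (signChangesFrom u i).encard := by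
  induction k generalizing σ i with
  | zero => simp
  | succ k ih =>
    obtain ⟨h1, j, hij, h2⟩ := h
    have hlt : u i * u j < 0 := by
      have := h2.pos
      by_contra h3
      push Not at h3
      have h4 := mul_pos h1 this
      nlinarith [mul_nonneg (sq_nonneg σ) h3]
    obtain ⟨p, q, hp, hpq, hq, hs, hz⟩ := exists_signChange_between hij hlt
    have hsub : insert (p, q) (signChangesFrom u j) ⊆ signChangesFrom u i := by
      rintro x (rfl | hx)
      · exact ⟨hp, hpq, hs, hz⟩
      · exact ⟨hij.le.trans hx.1, hx.2⟩
    have hnot : (p, q) ∉ signChangesFrom u j := fun hx =>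
      absurd hx.1 (not_le.2 (hpq.trans_le hq))
    calc ((k + 1 : ℕ) : ℕ∞) = k + 1 := by push_cast; rfl
      _ ≤ (signChangesFrom u j).encard + 1 := by gcongr; exact ih h2
      _ = (insert (p, q) (signChangesFrom u j)).encard := (Set.encard_insert_of_notMem hnot).symm
      _ ≤ _ := Set.encard_le_encard hsub

theorem AltFrom.le_variation {ι : Type*} [LinearOrder ι] [LocallyFiniteOrder ι]
    {u : ι → ℝ} {k : ℕ} {σ : ℝ} {i : ι} (h : AltFrom u k σ i) :
    (k : ℕ∞) ≤ variation u :=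
  h.le_encard.trans (Set.encard_le_encard fun _ hx => hx.2)

/-- Greedy construction: jump to the end `q` of the earliest sign change `(p, q)`. Its left entry
has the sign of `u i`, and every other change starts at or after `q`, so only one is used up. -/
theorem altFrom_of_le_encard {ι : Type*} [LinearOrder ι] [LocallyFiniteOrder ι] [WellFoundedLT ι]
    {u : ι → ℝ} {k : ℕ} {σ : ℝ} {i : ι} (hi : 0 < σ * u i)
    (h : (k : ℕ∞) ≤ (signChangesFrom u i).encard) : AltFrom u k σ i := by
  induction k generalizing σ i with
  | zero => exact hi
  | succ k ih =>
    have hne : (signChangesFrom u i).Nonempty := by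
      rw [Set.nonempty_iff_ne_empty]
      intro h0
      rw [h0] at h
      simp at h
    obtain ⟨p, ⟨q, hpq⟩, hmin⟩ : ∃ p, (∃ q, (p, q) ∈ signChangesFrom u i) ∧
        ∀ p' q', (p', q') ∈ signChangesFrom u i → p ≤ p' := by
      obtain ⟨⟨p0, q0⟩, h0⟩ := hne
      let T : Set ι := {p | ∃ q, (p, q) ∈ signChangesFrom u i}
      have hT : T.Nonempty := ⟨p0, q0, h0⟩
      exact ⟨WellFounded.min wellFounded_lt T hT, WellFounded.min_mem wellFounded_lt T hT,
        fun p' q' h' => not_lt.1 (WellFounded.not_lt_min wellFounded_lt T ⟨q', h'⟩)⟩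
    obtain ⟨hip, hlt, hs, hz⟩ := hpq
    simp only at hip hlt hs hz
    have hup : u p ≠ 0 := by intro h0; simp [h0] at hs
    have hui : u i ≠ 0 := by intro h0; simp [h0] at hi
    have hsame : 0 < u i * u p := by
      refine lt_of_le_of_ne (not_lt.1 fun hneg => ?_) (mul_ne_zero hui hup).symm
      rcases hip.eq_or_lt with he | hl
      · rw [he] at hneg; nlinarith
      · obtain ⟨p', q', h1, h2, h3, h4, h5⟩ := exists_signChange_between hl hneg
        exact absurd (hmin p' q' ⟨h1, h2, h4, h5⟩) (not_le.2 (h2.trans_le h3))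
    have hq : 0 < -σ * u q := by
      have h1 := pos_of_mul_pos_of_mul_pos (ε := 1) (by simpa using hsame) hi
      have h2 := pos_of_mul_pos_of_mul_pos (ε := -1) (x := u p) (y := u q) (σ := σ)
        (by simpa using hs) (by simpa using h1)
      simpa using h2
    refine ⟨hi, q, hip.trans_lt hlt, ih hq ?_⟩
    have hsub : signChangesFrom u i ⊆ insert (p, q) (signChangesFrom u q) := by
      rintro ⟨p', q'⟩ hx
      have hle := hmin p' q' hx
      obtain ⟨-, hx2, hx3, hx4⟩ := hx
      simp only at hx2 hx3 hx4
      have hup' : u p' ≠ 0 := by intro h0; simp [h0] at hx3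
      have huq' : u q' ≠ 0 := by intro h0; simp [h0] at hx3
      have huq : u q ≠ 0 := by intro h0; simp [h0] at hs
      rcases hle.eq_or_lt with rfl | hl
      · left
        rcases lt_trichotomy q q' with h1 | h1 | h1
        · exact absurd (hx4 q hlt h1) huq
        · rw [h1]
        · exact absurd (hz q' hx2 h1) huq'
      · right
        refine ⟨?_, hx2, hx3, hx4⟩
        by_contra h1
        exact hup' (hz p' hl (not_le.1 h1))
    have h1 := h.trans ((Set.encard_le_encard hsub).trans (Set.encard_insert_le _ _))
    push_cast at h1
    exact (ENat.add_le_add_iff_right (by simp)).1 h1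

theorem altFrom_of_le_variation {ι : Type*} [LinearOrder ι] [LocallyFiniteOrder ι]
    [WellFoundedLT ι] {u : ι → ℝ} {k : ℕ} {i : ι} (hi : IsFirstNonzero u i)
    (h : (k : ℕ∞) ≤ variation u) : AltFrom u k (u i) i := by
  refine altFrom_of_le_encard (mul_self_pos.2 hi.1) (h.trans (Set.encard_le_encard ?_))
  rintro x ⟨h1, h2, h3⟩
  refine ⟨?_, h1, h2, h3⟩
  by_contra h4
  have := hi.2 x.1 (not_le.1 h4)
  simp [this] at h2

theorem exists_isFirstNonzero {ι : Type*} [LinearOrder ι] [WellFoundedLT ι]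
    {u : ι → ℝ} (h : u ≠ 0) : ∃ i, IsFirstNonzero u i := by
  have hT : {i | u i ≠ 0}.Nonempty := Function.ne_iff.1 h
  refine ⟨WellFounded.min wellFounded_lt _ hT, WellFounded.min_mem wellFounded_lt _ hT,
    fun l hl => ?_⟩
  by_contra h0
  exact WellFounded.not_lt_min wellFounded_lt {i | u i ≠ 0} h0 hl

theorem variation_zero {ι : Type*} [LinearOrder ι] : variation (0 : ι → ℝ) = 0 := by
  simp [variation]

/-- The sign condition comes for free: if the variations agree but the first signs differ, the chain
pulled back to `u` starts after the first nonzero entry of `u`, and prepending that entry gives one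
sign change too many. -/
theorem isOVD_of_altFrom {ι : Type*} [LinearOrder ι] [LocallyFiniteOrder ι]
    {κ : Type*} [LinearOrder κ] [LocallyFiniteOrder κ] [WellFoundedLT κ] (k : ℕ)
    {D : Set (ι → ℝ)} {X : (ι → ℝ) → (κ → ℝ)}
    (h : ∀ u ∈ D, ∀ m σ j, AltFrom (X u) m σ j → ∃ i, AltFrom u m σ i) : IsOVD k D X := by
  intro u hu hk
  by_cases hX : X u = 0
  · rw [hX]
    refine ⟨by rw [variation_zero]; exact zero_le, fun _ i j _ hj => ?_⟩
    exact absurd rfl hj.1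
  obtain ⟨j, hj⟩ := exists_isFirstNonzero hX
  have hle : ∀ m : ℕ, (m : ℕ∞) ≤ variation (X u) → ∃ i, AltFrom u m (X u j) i := fun m hm =>
    h u hu m _ j (altFrom_of_le_variation hj hm)
  refine ⟨ENat.forall_natCast_le_iff_le.1 fun m hm => (hle m hm).choose_spec.le_variation, ?_⟩
  intro heq i j' hi hj'
  obtain rfl : j = j' := le_antisymm (not_lt.1 fun hl => hj'.1 (hj.2 _ hl))
    (not_lt.1 fun hl => hj.1 (hj'.2 _ hl))
  obtain ⟨m, hm⟩ := ENat.ne_top_iff_exists.1 (ne_top_of_le_ne_top (ENat.natCast_ne_top k) hk)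
  obtain ⟨i', hi'⟩ := hle m (by rw [heq, hm])
  by_contra hne
  have hopp : X u j * u i < 0 := by
    have h1 := hi.1
    have h2 := hj.1
    rcases lt_or_gt_of_ne h1 with h1 | h1 <;> rcases lt_or_gt_of_ne h2 with h2 | h2
    · exact absurd (by rw [sign_neg h1, sign_neg h2]) hne
    · exact mul_neg_of_pos_of_neg h2 h1
    · exact mul_neg_of_neg_of_pos h2 h1
    · exact absurd (by rw [sign_pos h1, sign_pos h2]) hne
  have hii : i < i' := by
    refine lt_of_le_of_ne (not_lt.1 fun hl => hi'.ne_zero (hi.2 _ hl)) ?_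
    rintro rfl
    exact absurd hi'.pos (not_lt.2 hopp.le)
  have hlong : AltFrom u (m + 1) (-(X u j)) i :=
    ⟨by rw [neg_mul]; exact neg_pos.2 hopp, i', hii, by rwa [neg_neg]⟩
  have := hlong.le_variation
  rw [← hm] at this
  norm_cast at this
  omega

theorem IsOVD.comp {ι κ μ : Type*} [LinearOrder ι] [LinearOrder κ] [WellFoundedLT κ]
    [LinearOrder μ] {k : ℕ} {D : Set (ι → ℝ)} {X : (ι → ℝ) → (κ → ℝ)} {Y : (κ → ℝ) → (μ → ℝ)}
    (hX : IsOVD k D X) (hY : IsOVD k Set.univ Y) (hY0 : Y 0 = 0) :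
    IsOVD k D (fun u => Y (X u)) := by
  intro u hu hk
  obtain ⟨h1, h2⟩ := hX u hu hk
  obtain ⟨h3, h4⟩ := hY (X u) trivial (h1.trans hk)
  refine ⟨h3.trans h1, fun heq i j hi hj => ?_⟩
  have e1 : variation (X u) = variation u := le_antisymm h1 (heq ▸ h3)
  -- The two sign comparisons are chained through the first nonzero entry of `X u`, which exists
  -- because `Y 0 = 0` while `Y (X u)` is nonzero.
  have hX0 : X u ≠ 0 := by
    intro h0
    exact hj.1 (by simp only [h0, hY0, Pi.zero_apply])
  obtain ⟨l, hl⟩ := exists_isFirstNonzero hX0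
  exact (h2 e1 i l hi hl).trans (h4 (by rw [heq, e1]) l j hl hj)

/-! ### Variation diminution of the observability operator -/

/-- A discrete Rolle theorem: otherwise `σ * y (s + 1) ≥ a * (σ * y s)` throughout, and `σ * y`
would stay nonnegative up to `t'`. -/
theorem exists_pos_mul_sub_succ {y : ℕ → ℝ} {a σ : ℝ} (ha : 0 ≤ a) {t t' : ℕ} (ht : t < t')
    (h : 0 < σ * y t) (h' : 0 < -σ * y t') :
    ∃ s, t ≤ s ∧ s < t' ∧ 0 < σ * (a * y s - y (s + 1)) := by
  by_contra hne
  push Not at hne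
  have hall : ∀ d, t + d ≤ t' → 0 ≤ σ * y (t + d) := by
    intro d
    induction d with
    | zero => exact fun _ => h.le
    | succ d ih =>
      intro hd
      have h1 := hne (t + d) (by omega) (by omega)
      have h2 := mul_nonneg ha (ih (by omega))
      rw [← add_assoc]
      linarith
  have := hall (t' - t) (by omega)
  rw [show t + (t' - t) = t' by omega] at this
  linarith

theorem AltFrom.mul_sub_succ {y : ℕ → ℝ} {a σ : ℝ} (ha : 0 ≤ a) {k t : ℕ}
    (h : AltFrom y (k + 1) σ t) :
    ∃ s, t ≤ s ∧ AltFrom (fun t => a * y t - y (t + 1)) k σ s := by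
  induction k generalizing σ t with
  | zero =>
    obtain ⟨h1, j, hj, h2⟩ := h
    obtain ⟨s, hs1, -, hs2⟩ := exists_pos_mul_sub_succ ha hj h1 h2.pos
    exact ⟨s, hs1, hs2⟩
  | succ k ih =>
    obtain ⟨h1, j, hj, h2⟩ := h
    obtain ⟨s, hs1, hs3, hs2⟩ := exists_pos_mul_sub_succ ha hj h1 h2.pos
    obtain ⟨s', hs', h3⟩ := ih h2
    exact ⟨s, hs1, hs2, s', by omega, h3⟩

/-- If the signs of `c` are reversed behind a suitable index `e`, then one sign change is lost. -/
theorem exists_flip {ι : Type*} [LinearOrder ι] [WellFoundedLT ι] {c : ι → ℝ} {σ : ℝ}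
    (hc : ∃ i, 0 < σ * c i) :
    ∃ e, ∀ d : ι → ℝ, d e = 0 → (∀ i, i < e → d i ≠ 0 → 0 < d i * c i) →
      (∀ i, e < i → d i ≠ 0 → d i * c i < 0) →
      ∀ k j, AltFrom d k σ j → ∃ i, AltFrom c (k + 1) σ i := by
  have hsame : ∀ {x y τ : ℝ}, 0 < x * y → 0 < τ * x → 0 < τ * y := fun h1 h2 => by
    simpa using pos_of_mul_pos_of_mul_pos (ε := 1) (by simpa using h1) h2
  have hopp : ∀ {x y τ : ℝ}, x * y < 0 → 0 < τ * x → τ * y < 0 := fun h1 h2 => by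
    simpa using pos_of_mul_pos_of_mul_pos (ε := -1) (by simpa using h1) h2
  -- If possible, `e` is the place where `c` first reaches sign `-σ` after sign `σ`; the change
  -- there is the one that the reversal destroys. If there is none, `e` is the first entry of sign
  -- `σ`, and then `d` has no entry of sign `σ` at all.
  by_cases hE : ∃ e, σ * c e < 0 ∧ ∃ i, i < e ∧ 0 < σ * c i
  · obtain ⟨⟨hce, i, hie, hci⟩, hmin⟩ := And.intro
      (WellFounded.min_mem wellFounded_lt {e | σ * c e < 0 ∧ ∃ i, i < e ∧ 0 < σ * c i} hE)
      (fun x => WellFounded.not_lt_min wellFounded_lt (x := x)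
        {e | σ * c e < 0 ∧ ∃ i, i < e ∧ 0 < σ * c i})
    set e := WellFounded.min wellFounded_lt {e | σ * c e < 0 ∧ ∃ i, i < e ∧ 0 < σ * c i} hE
    refine ⟨e, fun d hde hlt hgt k j hj => ?_⟩
    have hflip : ∀ {m τ l}, e < l → AltFrom d m τ l → AltFrom c m (-τ) l := fun hl h =>
      h.congr_sign_neg fun a ha h0 => hgt a (hl.trans_le ha) h0
    rcases lt_trichotomy j e with hje | rfl | hje
    · have hcj := hsame (hlt j hje hj.ne_zero) hj.pos
      refine ⟨j, hcj, e, hje, ?_⟩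
      cases k with
      | zero =>
        show 0 < -σ * c e
        linarith
      | succ k =>
        obtain ⟨-, l, hjl, hl⟩ := hj
        refine ⟨by linarith, l, ?_, ?_⟩
        · rcases lt_trichotomy l e with h | rfl | h
          · have := hsame (hlt l h hl.ne_zero) hl.pos
            exact absurd h (hmin l ⟨by linarith, j, hjl, hcj⟩)
          · exact absurd hde hl.ne_zero
          · exact h
        · rcases lt_trichotomy l e with h | rfl | h
          · have := hsame (hlt l h hl.ne_zero) hl.pos
            exact absurd h (hmin l ⟨by linarith, j, hjl, hcj⟩)
          · exact absurd hde hl.ne_zero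
          · exact hflip h hl
    · exact absurd hde hj.ne_zero
    · exact ⟨i, hci, j, hie.trans hje, hflip hje hj⟩
  · push Not at hE
    obtain ⟨he, hmin⟩ := And.intro (WellFounded.min_mem wellFounded_lt {i | 0 < σ * c i} hc)
      (fun x => WellFounded.not_lt_min wellFounded_lt (x := x) {i | 0 < σ * c i})
    set e := WellFounded.min wellFounded_lt {i | 0 < σ * c i} hc
    refine ⟨e, fun d hde hlt hgt k j hj => ?_⟩
    exfalso
    rcases lt_trichotomy j e with hje | rfl | hje
    · exact hmin j (hsame (hlt j hje hj.ne_zero) hj.pos) hje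
    · exact hj.ne_zero hde
    · exact absurd (hE j (hopp (hgt j hje hj.ne_zero) hj.pos) e hje) (not_le.2 he)

/-- Passing from `y t` to `p e * y t - y (t + 1)` multiplies `c i` by `p e - p i`. This shortens a
chain of `y` by at most one, and for the `e` of `exists_flip` a chain of the new coefficients yields
one of `c` that is longer by one. -/
theorem altFrom_of_expSum {n : ℕ} {p : Fin n → ℝ} (hp : StrictMono p) (hp0 : ∀ i, 0 ≤ p i)
    {k : ℕ} {σ : ℝ} {t : ℕ} (c : Fin n → ℝ)
    (h : AltFrom (fun t => ∑ i, c i * p i ^ t) k σ t) : ∃ i, AltFrom c k σ i := by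
  induction k generalizing c σ t with
  | zero =>
    by_contra hne
    push Not at hne
    refine absurd h.pos (not_lt.2 ?_)
    rw [Finset.mul_sum]
    refine Finset.sum_nonpos fun i _ => ?_
    have h1 : σ * c i ≤ 0 := not_lt.1 (hne i)
    rw [← mul_assoc]
    exact mul_nonpos_of_nonpos_of_nonneg h1 (pow_nonneg (hp0 i) t)
  | succ k ih =>
    obtain ⟨i, hi⟩ := ih c (h.mono (Nat.le_succ k))
    obtain ⟨e, he⟩ := exists_flip ⟨i, hi.pos⟩
    obtain ⟨s, -, hs⟩ := h.mul_sub_succ (hp0 e)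
    have hd : AltFrom (fun t => ∑ i, ((p e - p i) * c i) * p i ^ t) k σ s := by
      convert hs using 3 with t
      rw [Finset.mul_sum, ← Finset.sum_sub_distrib]
      exact Finset.sum_congr rfl fun i _ => by ring
    obtain ⟨j, hj⟩ := ih _ hd
    refine he (fun i => (p e - p i) * c i) (by simp) (fun i hie h0 => ?_) (fun i hie h0 => ?_) k j hj
    · have h1 : 0 < p e - p i := sub_pos.2 (hp hie)
      have h2 : c i ≠ 0 := right_ne_zero_of_mul h0
      have h3 : 0 < c i ^ 2 := by positivity
      calc 0 < (p e - p i) * c i ^ 2 := mul_pos h1 h3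
        _ = _ := by ring
    · have h1 : p e - p i < 0 := sub_neg.2 (hp hie)
      have h2 : c i ≠ 0 := right_ne_zero_of_mul h0
      have h3 : 0 < c i ^ 2 := by positivity
      calc (p e - p i) * c i * c i = (p e - p i) * c i ^ 2 := by ring
        _ < 0 := mul_neg_of_neg_of_pos h1 h3

/-! ### Variation diminution of the controllability operator -/

theorem summable_mul_pow {u : ℕ → ℝ} (hu : u ∈ boundedSeq) {x : ℝ} (h0 : 0 ≤ x) (h1 : x < 1) :
    Summable fun s => u s * x ^ s := by
  obtain ⟨M, hM⟩ := hu
  refine Summable.of_norm_bounded (g := fun s => M * x ^ s)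
    ((summable_geometric_of_lt_one h0 h1).mul_left M) fun s => ?_
  rw [norm_mul, norm_pow, Real.norm_eq_abs, Real.norm_eq_abs, abs_of_nonneg h0]
  exact mul_le_mul_of_nonneg_right (hM s) (pow_nonneg h0 s)

theorem continuousOn_tsum_mul_pow {u : ℕ → ℝ} (hu : u ∈ boundedSeq) {b : ℝ} (hb0 : 0 ≤ b)
    (hb : b < 1) : ContinuousOn (fun x : ℝ => ∑' s, u s * x ^ s) (Set.Icc 0 b) := by
  obtain ⟨M, hM⟩ := hu
  refine continuousOn_tsum (u := fun s => M * b ^ s) (fun s => by fun_prop)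
    ((summable_geometric_of_lt_one hb0 hb).mul_left M) fun s x hx => ?_
  rw [norm_mul, norm_pow, Real.norm_eq_abs, Real.norm_eq_abs, abs_of_nonneg hx.1]
  have hM0 : 0 ≤ M := (abs_nonneg _).trans (hM 0)
  exact mul_le_mul (hM s) (pow_le_pow_left₀ hx.1 hx.2 s) (pow_nonneg hx.1 s) hM0

/-- Between partial sums of opposite signs some increment points towards the later one, and after
the last sum of the chain some increment must point back towards the limit zero. That last return is
the sign change gained. -/
theorem exists_altFrom_of_partialSums_aux {w : ℕ → ℝ}
    (hw : Tendsto (fun n => ∑ j ∈ Finset.range n, w j) atTop (𝓝 0)) {k : ℕ} {σ : ℝ} {s : ℕ}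
    (h : AltFrom (fun s => ∑ j ∈ Finset.range (s + 1), w j) k σ s) :
    ∃ i, s < i ∧ AltFrom w k (-σ) i := by
  induction k generalizing σ s with
  | zero =>
    by_contra hne
    push Not at hne
    have hmono : ∀ d, σ * ∑ j ∈ Finset.range (s + 1), w j ≤
        σ * ∑ j ∈ Finset.range (s + 1 + d), w j := by
      intro d
      induction d with
      | zero => exact le_rfl
      | succ d ih =>
        refine ih.trans ?_
        rw [← add_assoc, Finset.sum_range_succ, mul_add]
        have h1 : -σ * w (s + 1 + d) ≤ 0 := not_lt.1 (hne (s + 1 + d) (by omega))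
        linarith
    have hlim : Tendsto (fun d => σ * ∑ j ∈ Finset.range (s + 1 + d), w j) atTop (𝓝 (σ * 0)) := by
      refine Tendsto.const_mul σ (hw.comp ?_)
      exact tendsto_atTop_mono (fun d => Nat.le_add_left d (s + 1)) tendsto_id
    have := ge_of_tendsto' hlim hmono
    rw [mul_zero] at this
    exact absurd h.pos (not_lt.2 this)
  | succ k ih =>
    obtain ⟨h1, s', hs, h2⟩ := h
    obtain ⟨i, hi, h3⟩ := ih h2
    have hj : ∃ j, s < j ∧ j ≤ s' ∧ 0 < -σ * w j := by
      by_contra hne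
      push Not at hne
      have hsplit : ∑ j ∈ Finset.range (s' + 1), w j = ∑ j ∈ Finset.range (s + 1), w j +
          ∑ j ∈ Finset.Ico (s + 1) (s' + 1), w j :=
        (Finset.sum_range_add_sum_Ico _ (by omega)).symm
      have hle : -σ * ∑ j ∈ Finset.Ico (s + 1) (s' + 1), w j ≤ 0 := by
        rw [Finset.mul_sum]
        refine Finset.sum_nonpos fun j hj => ?_
        rw [Finset.mem_Ico] at hj
        exact hne j (by omega) (by omega)
      have h4 := h2.pos
      simp only at h1 h4
      rw [hsplit, mul_add] at h4
      linarith
    obtain ⟨j, hj1, hj2, hj3⟩ := hj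
    exact ⟨j, hj1, hj3, i, by omega, h3⟩

/-- Partial sums that tend to zero have fewer sign changes than their increments. -/
theorem exists_altFrom_of_partialSums {w : ℕ → ℝ}
    (hw : Tendsto (fun n => ∑ j ∈ Finset.range n, w j) atTop (𝓝 0)) {k : ℕ} {σ : ℝ} {s : ℕ}
    (h : AltFrom (fun s => ∑ j ∈ Finset.range (s + 1), w j) k σ s) :
    ∃ i, AltFrom w (k + 1) σ i := by
  obtain ⟨i, hi, h1⟩ := exists_altFrom_of_partialSums_aux hw h
  have hj : ∃ j, j ≤ s ∧ 0 < σ * w j := by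
    by_contra hne
    push Not at hne
    have h2 := h.pos
    rw [Finset.mul_sum] at h2
    refine absurd h2 (not_lt.2 (Finset.sum_nonpos fun j hj => hne j ?_))
    rw [Finset.mem_range] at hj
    omega
  obtain ⟨j, hj1, hj2⟩ := hj
  exact ⟨j, hj2, i, by omega, h1⟩

/-- Division of a power series by `a - x` at a root `a`. -/
theorem exists_bounded_quotient {u : ℕ → ℝ} (hu : u ∈ boundedSeq) {a : ℝ} (h0 : 0 < a) (h1 : a < 1)
    (ha : ∑' s, u s * a ^ s = 0) :
    ∃ q ∈ boundedSeq, (∀ s, a ^ (s + 1) * q s = ∑ j ∈ Finset.range (s + 1), u j * a ^ j) ∧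
      ∀ x, 0 ≤ x → x < 1 → ∑' s, u s * x ^ s = (a - x) * ∑' s, q s * x ^ s := by
  have hsum := summable_mul_pow hu h0.le h1
  let q : ℕ → ℝ := fun s => (∑ j ∈ Finset.range (s + 1), u j * a ^ j) / a ^ (s + 1)
  have hq : ∀ s, a ^ (s + 1) * q s = ∑ j ∈ Finset.range (s + 1), u j * a ^ j := fun s =>
    mul_div_cancel₀ _ (pow_pos h0 _).ne'
  -- Since the whole series vanishes at `a`, each partial sum is minus a tail, and the tail is `O(a
  -- ^ (s + 1))`.
  have hqb : q ∈ boundedSeq := by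
    obtain ⟨M, hM⟩ := hu
    refine ⟨M * (1 - a)⁻¹, fun s => ?_⟩
    have h2 := hsum.sum_add_tsum_nat_add (s + 1)
    rw [ha] at h2
    have h3 : |∑' i, u (i + (s + 1)) * a ^ (i + (s + 1))| ≤ a ^ (s + 1) * (M * (1 - a)⁻¹) := by
      rw [← Real.norm_eq_abs]
      refine tsum_of_norm_bounded (g := fun i => a ^ (s + 1) * (M * a ^ i))
        (((hasSum_geometric_of_lt_one h0.le h1).mul_left M).mul_left _) fun i => ?_
      rw [norm_mul, norm_pow, Real.norm_eq_abs, Real.norm_eq_abs, abs_of_pos h0, pow_add]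
      calc |u (i + (s + 1))| * (a ^ i * a ^ (s + 1)) ≤ M * (a ^ i * a ^ (s + 1)) := by
            gcongr; exact hM _
        _ = _ := by ring
    have h4 : q s = -(∑' i, u (i + (s + 1)) * a ^ (i + (s + 1))) / a ^ (s + 1) := by
      rw [← eq_neg_iff_add_eq_zero] at h2
      simp only [q, h2]
    rw [h4, abs_div, abs_neg, abs_of_pos (pow_pos h0 _), div_le_iff₀ (pow_pos h0 _), mul_comm]
    linarith
  refine ⟨q, hqb, hq, fun x hx0 hx1 => ?_⟩
  have hrec : ∀ s, a * q (s + 1) = q s + u (s + 1) := by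
    intro s
    have e1 := hq (s + 1)
    rw [Finset.sum_range_succ, ← hq s] at e1
    have : a ^ (s + 1) * (a * q (s + 1)) = a ^ (s + 1) * (q s + u (s + 1)) := by
      linear_combination e1
    exact mul_left_cancel₀ (pow_pos h0 _).ne' this
  have hzero : a * q 0 = u 0 := by simpa using hq 0
  have sq := summable_mul_pow hqb hx0 hx1
  have su := summable_mul_pow hu hx0 hx1
  have su' : Summable fun s => u (s + 1) * x ^ (s + 1) := (summable_nat_add_iff 1).2 su
  have e1 : a * ∑' s, q s * x ^ s = a * q 0 + ∑' s, (x * (q s * x ^ s) + u (s + 1) * x ^ (s + 1)) := by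
    rw [sq.tsum_eq_zero_add, mul_add, ← tsum_mul_left]
    congr 1
    · simp
    · refine tsum_congr fun s => ?_
      linear_combination x ^ (s + 1) * hrec s
  rw [(sq.mul_left x).tsum_add su', tsum_mul_left] at e1
  rw [su.tsum_eq_zero_add]
  simp only [pow_zero, mul_one]
  linear_combination -e1 - hzero

/-- Divide out a root `a` between the first two points of the chain. Beyond `a` the factor `a - x`
is negative, so the rest of the chain passes to the quotient with initial sign `σ`. The quotient's
coefficients have the signs of partial sums tending to zero, which restores the lost sign change. -/
theorem altFrom_of_powerSum {ι : Type*} [LinearOrder ι] {p : ι → ℝ} (hp : StrictMono p)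
    (hp0 : ∀ i, 0 ≤ p i) (hp1 : ∀ i, p i < 1) {k : ℕ} {σ : ℝ} {i : ι} {u : ℕ → ℝ}
    (hu : u ∈ boundedSeq) (h : AltFrom (fun i => ∑' s, u s * p i ^ s) k σ i) :
    ∃ s, AltFrom u k σ s := by
  induction k generalizing u σ i with
  | zero =>
    by_contra hne
    push Not at hne
    refine absurd h.pos (not_lt.2 ?_)
    rw [← tsum_mul_left]
    refine tsum_nonpos fun s => ?_
    rw [← mul_assoc]
    exact mul_nonpos_of_nonpos_of_nonneg (not_lt.1 (hne s)) (pow_nonneg (hp0 i) s)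
  | succ k ih =>
    obtain ⟨h1, j, hij, h2⟩ := h
    obtain ⟨a, ⟨hai, haj⟩, hfa⟩ : ∃ a ∈ Set.Icc (p i) (p j), σ * ∑' s, u s * a ^ s = 0 := by
      have hc : ContinuousOn (fun x : ℝ => σ * ∑' s, u s * x ^ s) (Set.Icc (p i) (p j)) :=
        ((continuousOn_tsum_mul_pow hu (hp0 j) (hp1 j)).mono
          (Set.Icc_subset_Icc_left (hp0 i))).const_smul σ
      refine intermediate_value_Icc' (hp hij).le hc ⟨?_, h1.le⟩
      have := h2.pos
      change -σ * ∑' s, u s * p j ^ s > 0 at this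
      change σ * ∑' s, u s * p j ^ s ≤ 0
      linarith
    have hσ : σ ≠ 0 := by rintro rfl; simp at h1
    have hf0 : ∑' s, u s * a ^ s = 0 := (mul_eq_zero.1 hfa).resolve_left hσ
    have hai' : p i < a := lt_of_le_of_ne hai (by rintro rfl; rw [hfa] at h1; exact lt_irrefl _ h1)
    have haj' : a < p j := lt_of_le_of_ne haj (by rintro rfl; exact h2.ne_zero hf0)
    have ha0 : 0 < a := (hp0 i).trans_lt hai'
    have ha1 : a < 1 := haj'.trans (hp1 j)
    obtain ⟨q, hqb, hqs, hqf⟩ := exists_bounded_quotient hu ha0 ha1 hf0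
    have h3 : AltFrom (fun i => ∑' s, q s * p i ^ s) k (-(-σ)) j := by
      refine h2.congr_sign_neg fun l hl hne => ?_
      have hneg : a - p l < 0 := sub_neg.2 (haj'.trans_le (hp.monotone hl))
      have hql := hqf (p l) (hp0 l) (hp1 l)
      change (∑' s, u s * p l ^ s) ≠ 0 at hne
      change (∑' s, u s * p l ^ s) * ∑' s, q s * p l ^ s < 0
      rw [hql] at hne ⊢
      have : (∑' s, q s * p l ^ s) ≠ 0 := right_ne_zero_of_mul hne
      calc (a - p l) * (∑' s, q s * p l ^ s) * (∑' s, q s * p l ^ s)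
          = (a - p l) * (∑' s, q s * p l ^ s) ^ 2 := by ring
        _ < 0 := mul_neg_of_neg_of_pos hneg (by positivity)
    rw [neg_neg] at h3
    obtain ⟨s, hs⟩ := ih hqb h3
    have hs' : AltFrom (fun s => ∑ j ∈ Finset.range (s + 1), u j * a ^ j) k σ s := by
      refine hs.congr_sign fun l _ hne => ?_
      rw [← hqs l]
      calc 0 < a ^ (l + 1) * q l ^ 2 := by positivity
        _ = _ := by ring
    have hlim : Tendsto (fun n => ∑ j ∈ Finset.range n, u j * a ^ j) atTop (𝓝 0) := by
      rw [← hf0]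
      exact (summable_mul_pow hu ha0.le ha1).hasSum.tendsto_sum_nat
    obtain ⟨l, hl⟩ := exists_altFrom_of_partialSums hlim hs'
    refine ⟨l, hl.congr_sign fun m _ hne => ?_⟩
    have : u m ≠ 0 := left_ne_zero_of_mul hne
    calc 0 < u m ^ 2 * a ^ m := by positivity
      _ = _ := by ring

/-! ### Positive semidefiniteness of the Hankel matrices -/

theorem variation_lt_top_of_finite_support {ι : Type*} [LinearOrder ι] {u : ι → ℝ}
    (h : (Function.support u).Finite) : variation u < ⊤ := by
  refine Set.encard_lt_top_iff.2 ((h.prod h).subset ?_)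
  rintro ⟨a, b⟩ ⟨-, hab, -⟩
  exact ⟨fun h0 => by simp [h0] at hab, fun h0 => by simp [h0] at hab⟩

/-- The matrix `(g (i + j + e + 1))`. -/
def hankelMatrix (g : ℕ → ℝ) (N e : ℕ) : Matrix (Fin N) (Fin N) ℝ :=
  Matrix.of fun i j => g (i + (j + e + 1))

/-- The input is `v` delayed by `e`, so the first `N` outputs are `μ * v i`. For `μ < 0` they alone
have the variation of the input; the later outputs cannot add to it, and the reversed first sign is
a contradiction. -/
theorem IsHankelTotallyPositive.eigenvalue_nonneg {g : ℕ → ℝ} (hg : IsHankelTotallyPositive g)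
    {N : ℕ} (e : ℕ) {v : Fin N → ℝ} (hv : v ≠ 0) {μ : ℝ} (hμ : hankelMatrix g N e *ᵥ v = μ • v) :
    0 ≤ μ := by
  by_contra hneg
  push Not at hneg
  let φ : Fin N → ℕ := fun j => j + e
  have hφ : Function.Injective φ := fun a b hab => by
    simp only [φ, add_left_inj] at hab
    exact Fin.ext hab
  let u : ℕ → ℝ := Function.extend φ v fun _ => 0
  have huφ : ∀ j, u (φ j) = v j := fun j => hφ.extend_apply v _ j
  have hu0 : ∀ s, u s ≠ 0 → ∃ j, φ j = s := fun s hs => by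
    by_contra hne
    exact hs (Function.extend_apply' v _ s hne)
  have hfin : (Function.support u).Finite := (Set.finite_range φ).subset fun s hs => hu0 s hs
  have hy : ∀ i : Fin N, hankelOp g u i = μ * v i := by
    intro i
    have h1 : hankelOp g u i = ∑ j : Fin N, g (i + (φ j + 1)) * u (φ j) := by
      rw [hankelOp, ← hφ.tsum_eq (f := fun s => g (i + (s + 1)) * u s), tsum_fintype]
      intro s hs
      exact hu0 s (right_ne_zero_of_mul hs)
    have h2 := congrFun hμ i
    simp only [Matrix.mulVec, dotProduct, hankelMatrix, Matrix.of_apply, Pi.smul_apply,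
      smul_eq_mul] at h2
    rw [h1, ← h2]
    exact Finset.sum_congr rfl fun j _ => by rw [huφ]
  have hbd : u ∈ boundedSeq := by
    obtain ⟨M, hM⟩ := (hfin.image fun s => |u s|).bddAbove
    refine ⟨max M 0, fun s => ?_⟩
    by_cases hs : u s = 0
    · simp [hs]
    · exact le_max_of_le_left (hM ⟨s, hs, rfl⟩)
  obtain ⟨m, hm⟩ := ENat.ne_top_iff_exists.1 (variation_lt_top_of_finite_support hfin).ne
  obtain ⟨hle, hsame⟩ := hg (m + 1) (by omega) u hbd (by rw [← hm]; simp)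
  obtain ⟨i, hi, hi0⟩ := exists_isFirstNonzero hv
  have hiu : IsFirstNonzero u (φ i) := by
    refine ⟨by rwa [huφ], fun l hl => ?_⟩
    by_contra h0
    obtain ⟨j, rfl⟩ := hu0 l h0
    rw [huφ] at h0
    refine h0 (hi0 j ?_)
    simp only [φ] at hl
    exact Fin.lt_def.2 (by omega)
  have hiy : IsFirstNonzero (hankelOp g u) (i : ℕ) := by
    refine ⟨by rw [hy]; exact mul_ne_zero hneg.ne hi, fun l hl => ?_⟩
    have := hy ⟨l, hl.trans i.2⟩
    simp only at this
    rw [this, hi0 _ (Fin.lt_def.2 hl), mul_zero]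
  have hchain := altFrom_of_le_variation hiu (k := m) (by rw [hm])
  have hchain' := hchain.map (v := hankelOp g u) (ε := -1) (fun s => s - e)
    (fun a b _ ha hb hab => by
      obtain ⟨a, rfl⟩ := hu0 a ha
      obtain ⟨b, rfl⟩ := hu0 b hb
      simp only [φ] at hab ⊢
      omega)
    (fun a _ ha => by
      obtain ⟨a, rfl⟩ := hu0 a ha
      rw [huφ] at ha ⊢
      simp only [φ, add_tsub_cancel_right, hy]
      have : 0 < v a ^ 2 := by positivity
      nlinarith)
  have heq : variation (hankelOp g u) = variation u :=
    le_antisymm hle (hm ▸ hchain'.le_variation)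
  have hsign := hsame heq _ _ hiu hiy
  rw [huφ, hy, sign_mul, sign_neg hneg] at hsign
  rcases lt_or_gt_of_ne hi with h | h
  · rw [sign_neg h] at hsign
    exact absurd hsign (by decide)
  · rw [sign_pos h] at hsign
    exact absurd hsign (by decide)

theorem IsHankelTotallyPositive.posSemidef {g : ℕ → ℝ} (hg : IsHankelTotallyPositive g)
    (N e : ℕ) : (hankelMatrix g N e).PosSemidef := by
  have hH : (hankelMatrix g N e).IsHermitian := by
    ext i j
    simp only [hankelMatrix, Matrix.conjTranspose_apply, Matrix.of_apply, star_trivial]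
    congr 1
    omega
  refine hH.posSemidef_iff_eigenvalues_nonneg.2 fun i => ?_
  refine hg.eigenvalue_nonneg e ?_ (hH.mulVec_eigenvectorBasis i)
  intro h0
  refine hH.eigenvectorBasis.toBasis.ne_zero i ?_
  ext j
  simpa using congrFun h0 j

/-! ### Functionals with a nonzero annihilator -/

/-- The linear functional on polynomials with the moments `h`. -/
def momentFunctional (h : ℕ → ℝ) : ℝ[X] →ₗ[ℝ] ℝ :=
  Polynomial.lsum fun i => (LinearMap.lsmul ℝ ℝ).flip (h i)

theorem momentFunctional_apply (h : ℕ → ℝ) (q : ℝ[X]) :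
    momentFunctional h q = q.sum fun i a => a * h i := by
  simp [momentFunctional, Polynomial.lsum_apply]

theorem momentFunctional_monomial (h : ℕ → ℝ) (n : ℕ) (a : ℝ) :
    momentFunctional h (monomial n a) = a * h n := by
  rw [momentFunctional_apply]
  exact Polynomial.sum_monomial_index a (fun i a => a * h i) (zero_mul _)

theorem momentFunctional_X_pow (h : ℕ → ℝ) (n : ℕ) : momentFunctional h (X ^ n) = h n := by
  rw [← Polynomial.monomial_one_right_eq_X_pow, momentFunctional_monomial, one_mul]

theorem momentFunctional_X_pow_mul (h : ℕ → ℝ) (e : ℕ) (q : ℝ[X]) :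
    momentFunctional h (X ^ e * q) = momentFunctional (fun t => h (t + e)) q := by
  induction q using Polynomial.induction_on' with
  | add p q hp hq => rw [mul_add, map_add, map_add, hp, hq]
  | monomial n a =>
    rw [X_pow_mul_monomial, momentFunctional_monomial, momentFunctional_monomial]

theorem momentFunctional_mul (h : ℕ → ℝ) (p q : ℝ[X]) {N : ℕ} (hp : p.natDegree < N)
    (hq : q.natDegree < N) :
    momentFunctional h (p * q) = ∑ i : Fin N, ∑ j : Fin N, p.coeff i * q.coeff j * h (i + j) := by
  conv_lhs => rw [p.as_sum_range' N hp, q.as_sum_range' N hq]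
  rw [Finset.sum_mul_sum, map_sum, Finset.sum_range]
  refine Finset.sum_congr rfl fun i _ => ?_
  rw [map_sum, Finset.sum_range]
  refine Finset.sum_congr rfl fun j _ => ?_
  rw [Polynomial.monomial_mul_monomial, momentFunctional_monomial]

theorem IsHankelTotallyPositive.momentFunctional_nonneg {g : ℕ → ℝ}
    (hg : IsHankelTotallyPositive g) (e : ℕ) (q : ℝ[X]) :
    0 ≤ momentFunctional (fun t => g (t + 1)) (X ^ e * (q * q)) := by
  set N := q.natDegree + e + 1 with hN
  have h1 : 0 ≤ (fun i : Fin N => q.coeff i) ⬝ᵥ hankelMatrix g N e *ᵥ (fun i => q.coeff i) :=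
    (hg.posSemidef N e).dotProduct_mulVec_nonneg _
  simp only [dotProduct, Matrix.mulVec, Finset.mul_sum] at h1
  rw [momentFunctional_X_pow_mul, momentFunctional_mul _ q q (N := N) (by omega) (by omega)]
  refine h1.trans_eq (Finset.sum_congr rfl fun i _ => Finset.sum_congr rfl fun j _ => ?_)
  rw [hankelMatrix, Matrix.of_apply, show (i : ℕ) + (j + e + 1) = i + j + e + 1 by omega]
  ring

section Functional

variable {L : ℝ[X] →ₗ[ℝ] ℝ}

/-- The largest ideal in the kernel of a functional. -/
def annihilatorIdeal (L : ℝ[X] →ₗ[ℝ] ℝ) : Ideal ℝ[X] where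
  carrier := {q | ∀ s, L (q * s) = 0}
  add_mem' := fun {a b} ha hb s => by rw [add_mul, map_add, ha, hb, add_zero]
  zero_mem' := fun s => by rw [zero_mul, map_zero]
  smul_mem' := fun c q hq s => by rw [smul_eq_mul, mul_comm c, mul_assoc, hq]

/-- The degenerate case of Cauchy–Schwarz for the form `L (a * b)`. -/
theorem mem_annihilatorIdeal_of_apply_mul_self (hpos : ∀ q, 0 ≤ L (q * q)) {q : ℝ[X]}
    (hq : L (q * q) = 0) : q ∈ annihilatorIdeal L := by
  intro s
  have key : ∀ x : ℝ, 0 ≤ L (s * s) + 2 * x * L (q * s) := by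
    intro x
    have h1 := hpos (s + x • q)
    have h2 : (s + x • q) * (s + x • q) = s * s + (2 * x) • (q * s) + (x * x) • (q * q) := by
      simp only [smul_eq_C_mul, map_mul, map_ofNat]
      ring
    rw [h2, map_add, map_add, map_smul, map_smul, hq, smul_eq_mul, smul_eq_mul, mul_zero,
      add_zero] at h1
    exact h1
  by_contra h0
  -- At this point the affine function in `key` takes the value `-1`.
  have h1 := key (-(L (s * s) + 1) / (2 * L (q * s)))
  have h2 : 2 * (-(L (s * s) + 1) / (2 * L (q * s))) * L (q * s) = -(L (s * s) + 1) := by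
    field_simp
  linarith

theorem left_mem_annihilatorIdeal (hpos : ∀ q, 0 ≤ L (q * q)) {a b : ℝ[X]}
    (h : a * a + b * b ∈ annihilatorIdeal L) : a ∈ annihilatorIdeal L := by
  have h1 := h 1
  rw [mul_one, map_add] at h1
  refine mem_annihilatorIdeal_of_apply_mul_self hpos ?_
  linarith [hpos a, hpos b]

/-- The generator of the annihilator of a nonnegative functional has simple real roots only. -/
theorem splits_separable_of_span_eq (hpos : ∀ q, 0 ≤ L (q * q)) {P : ℝ[X]} (hP0 : P ≠ 0)
    (hP : ∀ q, q ∈ annihilatorIdeal L ↔ P ∣ q) : P.Splits ∧ P.Separable := by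
  constructor
  · suffices hlin : ∀ f : ℝ[X], Irreducible f → f ∣ P → f.degree = 1 by
      obtain ⟨v, hv⟩ := UniqueFactorizationMonoid.factors_prod hP0
      rw [← hv]
      exact (Splits.multisetProd fun f hf => Splits.of_degree_eq_one (hlin f
        (UniqueFactorizationMonoid.irreducible_of_factor f hf)
        (UniqueFactorizationMonoid.dvd_of_mem_factors hf))).mul v.isUnit.splits
    intro f hf hfP
    obtain ⟨z, hz⟩ : ∃ z : ℂ, aeval z f = 0 :=
      IsAlgClosed.exists_aeval_eq_zero _ f (degree_pos_of_irreducible hf).ne'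
    by_cases him : z.im = 0
    · obtain ⟨x, rfl⟩ : ∃ x : ℝ, (x : ℂ) = z := ⟨z.re, Complex.ext rfl him.symm⟩
      refine degree_eq_one_of_irreducible_of_root hf (x := x) ?_
      have : aeval ((algebraMap ℝ ℂ) x) f = 0 := hz
      rw [aeval_algebraMap_apply, map_eq_zero] at this
      simpa using this
    · exfalso
      obtain ⟨s, hs⟩ := (quadratic_dvd_of_aeval_eq_zero_im_ne_zero f hz him).trans hfP
      have hnorm : ‖z‖ ^ 2 = z.re ^ 2 + z.im ^ 2 := by
        rw [← Complex.normSq_eq_norm_sq, Complex.normSq_apply]; ring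
      have hQ : X ^ 2 - C (2 * z.re) * X + C (‖z‖ ^ 2) =
          (X - C z.re) * (X - C z.re) + C z.im * C z.im := by
        rw [hnorm]
        simp only [map_mul, map_add, map_pow, map_ofNat]
        ring
      -- With `P` equal to the quadratic times `s`, this sum of squares is `P * s`. So `C z.im * s`,
      -- hence `s`, is a multiple of `P`, although its degree is smaller by two.
      have hmem : (C z.im * s) * (C z.im * s) + ((X - C z.re) * s) * ((X - C z.re) * s) ∈
          annihilatorIdeal L := by
        rw [hP]
        refine ⟨s, ?_⟩
        rw [hs, hQ]
        ring
      have hs' : P ∣ C z.im * s := (hP _).1 (left_mem_annihilatorIdeal hpos hmem)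
      have hunit : IsUnit (C z.im) := isUnit_C.2 (isUnit_iff_ne_zero.2 him)
      rw [hunit.dvd_mul_left] at hs'
      have hs0 : s ≠ 0 := by rintro rfl; rw [mul_zero] at hs; exact hP0 hs
      have hdeg := natDegree_le_of_dvd hs' hs0
      have hQ2 : (X ^ 2 - C (2 * z.re) * X + C (‖z‖ ^ 2)).natDegree = 2 := by compute_degree!
      have hQ0 : X ^ 2 - C (2 * z.re) * X + C (‖z‖ ^ 2) ≠ 0 := by
        intro h0; rw [h0] at hQ2; simp at hQ2
      rw [hs, natDegree_mul hQ0 hs0, hQ2] at hdeg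
      omega
  · rw [PerfectField.separable_iff_squarefree, ← isRadical_iff_squarefree_of_ne_zero hP0,
      isRadical_iff_pow_one_lt 2 one_lt_two]
    intro q hq
    rw [← hP] at hq ⊢
    refine left_mem_annihilatorIdeal (b := 0) hpos ?_
    rwa [mul_zero, add_zero, ← sq]

/-- `L q` depends only on the values of `q` at the simple real roots of the generator. Interpolation
there gives weights `L (ℓ x) = L (ℓ x * ℓ x)`, and `x * L (ℓ x) = L (X * (ℓ x * ℓ x))` makes the
nodes nonnegative. -/
theorem exists_atoms (hpos : ∀ q, 0 ≤ L (q * q)) (hpos' : ∀ q, 0 ≤ L (X * (q * q)))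
    (hne : annihilatorIdeal L ≠ ⊥) :
    ∃ (s : Finset ℝ) (r : ℝ → ℝ), (∀ x ∈ s, 0 ≤ x ∧ 0 < r x) ∧
      ∀ q, L q = ∑ x ∈ s, r x * q.eval x := by
  set P := Submodule.IsPrincipal.generator (annihilatorIdeal L) with hPdef
  have hP : ∀ q, q ∈ annihilatorIdeal L ↔ P ∣ q := fun q =>
    Submodule.IsPrincipal.mem_iff_generator_dvd _
  have hP0 : P ≠ 0 := fun h0 => hne ((Submodule.IsPrincipal.eq_bot_iff_generator_eq_zero _).2 h0)
  obtain ⟨hsplit, hsep⟩ := splits_separable_of_span_eq hpos hP0 hP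
  classical
  set s := P.roots.toFinset with hsdef
  have hroots : P.roots = s.val := by
    rw [hsdef, Multiset.toFinset_val, Multiset.dedup_eq_self.2 (nodup_roots hsep)]
  have hmem : ∀ q : ℝ[X], (∀ x ∈ s, q.eval x = 0) → q ∈ annihilatorIdeal L := by
    intro q hq
    rw [hP, hsplit.eq_prod_roots, hroots]
    have hunit : IsUnit (C P.leadingCoeff) :=
      isUnit_C.2 (isUnit_iff_ne_zero.2 (leadingCoeff_ne_zero.2 hP0))
    rw [hunit.mul_left_dvd]
    refine Finset.prod_dvd_of_coprime ?_ fun x hx => ?_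
    · exact fun x _ y _ hxy => isCoprime_X_sub_C_of_isUnit_sub
        (isUnit_iff_ne_zero.2 (sub_ne_zero.2 hxy))
    · exact dvd_iff_isRoot.2 (hq x hx)
  have hzero : ∀ q ∈ annihilatorIdeal L, L q = 0 := fun q hq => by simpa using hq 1
  have hcongr : ∀ q q' : ℝ[X], (∀ x ∈ s, q.eval x = q'.eval x) → L q = L q' := by
    intro q q' h
    rw [← sub_eq_zero, ← map_sub]
    exact hzero _ (hmem _ fun x hx => by rw [eval_sub, h x hx, sub_self])
  let ℓ : ℝ → ℝ[X] := fun x => Lagrange.basis s id x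
  have hℓ1 : ∀ x ∈ s, (ℓ x).eval x = 1 := fun x hx =>
    Lagrange.eval_basis_self (v := id) (Set.injOn_id _) hx
  have hℓ0 : ∀ x, ∀ y ∈ s, x ≠ y → (ℓ x).eval y = 0 := fun x y hy hxy =>
    Lagrange.eval_basis_of_ne (v := id) hxy hy
  have hsq : ∀ x ∈ s, L (ℓ x * ℓ x) = L (ℓ x) := fun x hx => hcongr _ _ fun y hy => by
    rw [eval_mul]
    rcases eq_or_ne x y with rfl | hxy
    · rw [hℓ1 x hx, one_mul]
    · rw [hℓ0 x y hy hxy, zero_mul]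
  have hr : ∀ x ∈ s, 0 < L (ℓ x) := by
    intro x hx
    refine lt_of_le_of_ne (hsq x hx ▸ hpos _) fun h0 => ?_
    have h1 := mem_annihilatorIdeal_of_apply_mul_self hpos ((hsq x hx).trans h0.symm)
    rw [hP] at h1
    have h2 : (ℓ x).eval x = 0 := eval_eq_zero_of_dvd_of_eval_eq_zero h1
      ((mem_roots hP0).1 (Multiset.mem_toFinset.1 hx))
    rw [hℓ1 x hx] at h2
    exact one_ne_zero h2
  refine ⟨s, fun x => L (ℓ x), fun x hx => ⟨?_, hr x hx⟩, fun q => ?_⟩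
  · have h1 : L (X * (ℓ x * ℓ x)) = L (x • ℓ x) := hcongr _ _ fun y hy => by
      rw [eval_mul, eval_mul, eval_X, eval_smul, smul_eq_mul]
      rcases eq_or_ne x y with rfl | hxy
      · rw [hℓ1 x hx, one_mul]
      · rw [hℓ0 x y hy hxy, zero_mul, mul_zero, mul_zero]
    have h2 := hpos' (ℓ x)
    rw [h1, map_smul, smul_eq_mul] at h2
    exact nonneg_of_mul_nonneg_left h2 (hr x hx)
  · have h1 : L q = L (∑ x ∈ s, q.eval x • ℓ x) := hcongr _ _ fun y hy => by
      rw [eval_finsetSum, Finset.sum_eq_single y]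
      · rw [eval_smul, hℓ1 y hy, smul_eq_mul, mul_one]
      · intro x _ hxy
        rw [eval_smul, hℓ0 x y hy hxy, smul_zero]
      · exact fun h => absurd hy h
    rw [h1, map_sum]
    refine Finset.sum_congr rfl fun x _ => ?_
    rw [map_smul, smul_eq_mul, mul_comm]

end Functional

/-! ### Rational transfer functions -/

theorem summable_mul_inv_pow {h : ℕ → ℝ} (hh : Summable h) {z : ℝ} (hz : 1 ≤ z) (e : ℕ) :
    Summable fun t => h t * (z ^ (t + e))⁻¹ := by
  refine Summable.of_norm_bounded (g := fun t => |h t|) (summable_abs_iff.2 hh) fun t => ?_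
  rw [norm_mul, Real.norm_eq_abs, norm_inv, norm_pow, Real.norm_of_nonneg (by linarith)]
  exact mul_le_of_le_one_right (abs_nonneg _) (inv_le_one_of_one_le₀ (one_le_pow₀ hz))

/-- The transfer function `∑ h(t) z⁻⁽ᵗ⁺¹⁾` of the delayed sequence `h`. -/
def delayedTransform (h : ℕ → ℝ) (z : ℝ) : ℝ := ∑' t, h t * (z ^ (t + 1))⁻¹

theorem mul_delayedTransform {h : ℕ → ℝ} (hh : Summable h) {z : ℝ} (hz : 1 ≤ z) :
    z * delayedTransform h z = h 0 + delayedTransform (fun t => h (t + 1)) z := by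
  have hz0 : z ≠ 0 := by linarith
  rw [delayedTransform, delayedTransform, (summable_mul_inv_pow hh hz 1).tsum_eq_zero_add, mul_add,
    ← tsum_mul_left]
  congr 1
  · field_simp
    ring
  · refine tsum_congr fun t => ?_
    field_simp
    ring

theorem abs_mul_delayedTransform_le {h : ℕ → ℝ} (hh : Summable h) {z : ℝ} (hz : 1 ≤ z) :
    |z * delayedTransform h z| ≤ ∑' t, |h t| := by
  rw [delayedTransform, ← tsum_mul_left, ← Real.norm_eq_abs]
  refine tsum_of_norm_bounded (summable_abs_iff.2 hh).hasSum fun t => ?_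
  have hz0 : 0 < z := by linarith
  rw [show z * (h t * (z ^ (t + 1))⁻¹) = h t * (z ^ t)⁻¹ by field_simp; ring, norm_mul,
    Real.norm_eq_abs, norm_inv, norm_pow, Real.norm_of_nonneg hz0.le]
  exact mul_le_of_le_one_right (abs_nonneg _) (inv_le_one_of_one_le₀ (one_le_pow₀ hz))

theorem tendsto_delayedTransform {h : ℕ → ℝ} (hh : Summable h) :
    Tendsto (delayedTransform h) atTop (𝓝 0) := by
  have h1 : Tendsto (fun z : ℝ => (∑' t, |h t|) * z⁻¹) atTop (𝓝 0) := by
    simpa using tendsto_inv_atTop_zero.const_mul (∑' t, |h t|)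
  refine squeeze_zero_norm' ?_ h1
  filter_upwards [eventually_ge_atTop 1] with z hz
  have hz0 : 0 < z := by linarith
  have h2 := abs_mul_delayedTransform_le hh hz
  rw [abs_mul, abs_of_pos hz0] at h2
  rw [Real.norm_eq_abs, ← div_eq_mul_inv, le_div_iff₀ hz0]
  linarith

/-- The transform tends to `0` at infinity, so `Q = 0`; multiplying by `z` then isolates `h 0`, and
the shifted sequence is treated in the same way. -/
theorem eq_zero_of_delayedTransform_eq_eval {h : ℕ → ℝ} (hh : Summable h) {Q : ℝ[X]}
    (hQ : ∀ z, 1 ≤ z → delayedTransform h z = Q.eval z) (t : ℕ) : h t = 0 := by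
  induction t generalizing h Q with
  | zero =>
    have h1 : Tendsto (fun z => Q.eval z) atTop (𝓝 0) := by
      refine (tendsto_delayedTransform hh).congr' ?_
      filter_upwards [eventually_ge_atTop 1] with z hz using hQ z hz
    have hQ0 : Q = 0 := by
      obtain ⟨h2, h3⟩ := Q.tendsto_nhds_iff.1 h1
      rwa [leadingCoeff_eq_zero] at h2
    have h4 : Tendsto (delayedTransform fun t => h (t + 1)) atTop (𝓝 (-h 0)) := by
      refine tendsto_const_nhds.congr' ?_
      filter_upwards [eventually_ge_atTop 1] with z hz
      have h5 := mul_delayedTransform hh hz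
      rw [hQ z hz, hQ0, eval_zero, mul_zero] at h5
      linarith
    have h6 := tendsto_nhds_unique h4 (tendsto_delayedTransform ((summable_nat_add_iff 1).2 hh))
    linarith
  | succ t ih =>
    refine ih (h := fun t => h (t + 1)) (Q := X * Q - C (h 0)) ((summable_nat_add_iff 1).2 hh)
      fun z hz => ?_
    have h5 := mul_delayedTransform hh hz
    rw [hQ z hz] at h5
    rw [eval_sub, eval_mul, eval_X, eval_C]
    linarith

/-- Multiplication by `z` shifts the sequence and splits off a constant, so multiplication by `P`
acts on the sequence as `P` of the shift, up to a polynomial. -/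
theorem exists_eval_mul_delayedTransform {h : ℕ → ℝ} (hh : Summable h) (P : ℝ[X]) :
    Summable (fun t => momentFunctional h (X ^ t * P)) ∧
    ∃ Q : ℝ[X], ∀ z, 1 ≤ z → P.eval z * delayedTransform h z =
      Q.eval z + delayedTransform (fun t => momentFunctional h (X ^ t * P)) z := by
  induction P using Polynomial.induction_on with
  | C a =>
    have h1 : ∀ t, momentFunctional h (X ^ t * C a) = a * h t := fun t => by
      rw [mul_comm, ← smul_eq_C_mul, map_smul, momentFunctional_X_pow, smul_eq_mul]
    simp only [h1]
    refine ⟨hh.mul_left a, 0, fun z _ => ?_⟩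
    rw [eval_C, eval_zero, zero_add, delayedTransform, delayedTransform, ← tsum_mul_left]
    simp only [mul_assoc]
  | add P P' hP hP' =>
    obtain ⟨h1, Q, hQ⟩ := hP
    obtain ⟨h2, Q', hQ'⟩ := hP'
    simp only [mul_add, map_add]
    refine ⟨h1.add h2, Q + Q', fun z hz => ?_⟩
    rw [eval_add, eval_add, add_mul, hQ z hz, hQ' z hz]
    simp only [delayedTransform, add_mul]
    rw [(summable_mul_inv_pow h1 hz 1).tsum_add (summable_mul_inv_pow h2 hz 1)]
    ring
  | monomial n a ih =>
    obtain ⟨h1, Q, hQ⟩ := ih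
    have h2 : ∀ t, momentFunctional h (X ^ t * (C a * X ^ (n + 1))) =
        momentFunctional h (X ^ (t + 1) * (C a * X ^ n)) := fun t => by
      congr 1
      ring
    simp only [h2]
    set m : ℕ → ℝ := fun t => momentFunctional h (X ^ t * (C a * X ^ n)) with hm
    refine ⟨(summable_nat_add_iff (f := m) 1).2 h1, X * Q + C (m 0), fun z hz => ?_⟩
    have h3 := mul_delayedTransform h1 hz
    have h4 := hQ z hz
    simp only [eval_mul, eval_C, eval_pow, eval_X, eval_add] at h4 ⊢
    rw [add_assoc, ← h3]
    linear_combination z * h4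

theorem IsTransferFunction.num_eval {g : ℕ → ℝ} {G : RatFunc ℝ} (hG : IsTransferFunction g G)
    (hg0 : g 0 = 0) {z : ℝ} (hz : 1 ≤ z) :
    G.num.eval z = G.denom.eval z * delayedTransform (fun t => g (t + 1)) z := by
  obtain ⟨h1, h2⟩ := hG z (by rw [Complex.norm_real, Real.norm_of_nonneg (by linarith)]; exact hz)
  have e : ∀ q : ℝ[X], q.eval₂ (algebraMap ℝ ℂ) (z : ℂ) = ((q.eval z : ℝ) : ℂ) := fun q => by
    rw [← Complex.coe_algebraMap, eval₂_at_apply]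
  have h1' : G.denom.eval z ≠ 0 := by
    intro h0
    apply h1
    rw [aeval_def, e, h0, Complex.ofReal_zero]
  have h3 : HasSum (fun t => g t * (z ^ t)⁻¹) (G.num.eval z / G.denom.eval z) := by
    rw [RatFunc.eval, e, e] at h2
    exact_mod_cast h2
  have h4 := (hasSum_nat_add_iff' 1).2 h3
  rw [Finset.sum_range_one, hg0, zero_mul, sub_zero] at h4
  rw [delayedTransform, h4.tsum_eq, mul_div_cancel₀ _ h1']

theorem IsTransferFunction.denom_mem {g : ℕ → ℝ} {G : RatFunc ℝ} (hG : IsTransferFunction g G)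
    (hg : Summable g) (hg0 : g 0 = 0) :
    G.denom ∈ annihilatorIdeal (momentFunctional fun t => g (t + 1)) := by
  obtain ⟨h1, Q, hQ⟩ := exists_eval_mul_delayedTransform ((summable_nat_add_iff 1).2 hg) G.denom
  have h2 := eq_zero_of_delayedTransform_eq_eval h1 (Q := G.num - Q) fun z hz => by
    rw [eval_sub, hG.num_eval hg0 hz, hQ z hz, add_sub_cancel_left]
  intro s
  induction s using Polynomial.induction_on' with
  | add p q hp hq => rw [mul_add, map_add, hp, hq, add_zero]
  | monomial n a =>
    rw [← C_mul_X_pow_eq_monomial, mul_left_comm, ← smul_eq_C_mul, map_smul, mul_comm _ (X ^ n), h2,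
      smul_zero]

theorem delayedTransform_expSum {n : ℕ} {p r : Fin n → ℝ} (hp0 : ∀ i, 0 ≤ p i)
    (hp1 : ∀ i, p i < 1) {z : ℝ} (hz : 1 ≤ z) :
    delayedTransform (fun t => ∑ i, r i * p i ^ t) z = ∑ i, r i / (z - p i) := by
  have hz0 : 0 < z := by linarith
  have h1 : ∀ i, HasSum (fun t => r i * p i ^ t * (z ^ (t + 1))⁻¹) (r i / (z - p i)) := by
    intro i
    have h2 : p i / z < 1 := (div_lt_one hz0).2 ((hp1 i).trans_le hz)
    have h3 := (hasSum_geometric_of_lt_one (div_nonneg (hp0 i) hz0.le) h2).mul_left (r i / z)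
    have h4 : z - p i ≠ 0 := by linarith [hp1 i]
    have h5 : r i / z * (1 - p i / z)⁻¹ = r i / (z - p i) := by
      rw [show (1 : ℝ) - p i / z = (z - p i) / z by field_simp]
      field_simp
    rw [h5] at h3
    refine h3.congr_fun fun t => ?_
    rw [div_pow, pow_succ]
    field_simp
  rw [delayedTransform]
  simp only [Finset.sum_mul]
  exact (hasSum_sum fun i _ => h1 i).tsum_eq

/-- Agreement at infinitely many reals identifies `G` with the partial fractions. No factor `X - C
(p i)` cancels, because the combined numerator at `p i` is `r i * ∏ (p i - p j) ≠ 0`. -/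
theorem eq_sum_and_denom_eq {G : RatFunc ℝ} {n : ℕ} {p r : Fin n → ℝ} (hp : StrictMono p)
    (hp1 : ∀ i, p i < 1) (hr : ∀ i, 0 < r i)
    (hG : ∀ z : ℝ, 1 ≤ z → G.num.eval z = G.denom.eval z * ∑ i, r i / (z - p i)) :
    G = ∑ i, RatFunc.C (r i) / (RatFunc.X - RatFunc.C (p i)) ∧
      G.denom = ∏ i, (X - C (p i)) := by
  set P : ℝ[X] := ∏ i, (X - C (p i)) with hPdef
  set S : ℝ[X] := ∑ i, C (r i) * ∏ j ∈ Finset.univ.erase i, (X - C (p j)) with hSdef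
  have hPm : P.Monic := monic_prod_of_monic _ _ fun i _ => monic_X_sub_C _
  have hNS : G.num * P = S * G.denom := by
    refine eq_of_infinite_eval_eq _ _ ((Set.Ici_infinite (1 : ℝ)).mono fun z hz => ?_)
    have hz' : ∀ i, z - p i ≠ 0 := fun i => by
      have := hp1 i
      have : (1 : ℝ) ≤ z := hz
      linarith
    have hS : S.eval z = (∑ i, r i / (z - p i)) * P.eval z := by
      rw [hSdef, hPdef, eval_finsetSum, eval_prod, Finset.sum_mul]
      refine Finset.sum_congr rfl fun i _ => ?_
      rw [← Finset.mul_prod_erase _ _ (Finset.mem_univ i), eval_mul, eval_C, eval_prod]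
      simp only [eval_sub, eval_X, eval_C]
      rw [← mul_assoc, div_mul_cancel₀ _ (hz' i)]
    rw [Set.mem_ofPred_eq, eval_mul, eval_mul, hS, hG z hz]
    ring
  have hinj := IsFractionRing.injective ℝ[X] (RatFunc ℝ)
  have hne : ∀ q : ℝ[X], q ≠ 0 → algebraMap ℝ[X] (RatFunc ℝ) q ≠ 0 := fun q hq h0 =>
    hq (hinj (h0.trans (map_zero _).symm))
  have hGSP : G = algebraMap ℝ[X] (RatFunc ℝ) S / algebraMap ℝ[X] (RatFunc ℝ) P := by
    conv_lhs => rw [← RatFunc.num_div_denom G]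
    rw [div_eq_div_iff (hne _ G.denom_ne_zero) (hne _ hPm.ne_zero), ← map_mul, ← map_mul, hNS]
  refine ⟨?_, ?_⟩
  · rw [hGSP, hSdef, map_sum, Finset.sum_div]
    refine Finset.sum_congr rfl fun i _ => ?_
    have hXi : algebraMap ℝ[X] (RatFunc ℝ) (X - C (p i)) ≠ 0 := hne _ (X_sub_C_ne_zero _)
    have hPi : algebraMap ℝ[X] (RatFunc ℝ) (∏ j ∈ Finset.univ.erase i, (X - C (p j))) ≠ 0 :=
      hne _ (monic_prod_of_monic _ _ fun j _ => monic_X_sub_C _).ne_zero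
    rw [← RatFunc.algebraMap_C, ← RatFunc.algebraMap_C, ← RatFunc.algebraMap_X, ← map_sub, hPdef,
      ← Finset.mul_prod_erase _ _ (Finset.mem_univ i), map_mul, map_mul,
      mul_div_mul_right _ _ hPi]
  · refine eq_of_monic_of_associated G.monic_denom hPm (associated_of_dvd_dvd ?_ ?_)
    · conv_lhs => rw [hGSP]
      exact RatFunc.denom_div_dvd _ _
    · refine Finset.prod_dvd_of_coprime ?_ fun i _ => ?_
      · exact fun i _ j _ hij => isCoprime_X_sub_C_of_isUnit_sub
          (isUnit_iff_ne_zero.2 (sub_ne_zero.2 (hp.injective.ne hij)))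
      · rw [dvd_iff_isRoot]
        have h1 := congrArg (eval (p i)) hNS
        have hPi : P.eval (p i) = 0 := by
          rw [hPdef, eval_prod]
          exact Finset.prod_eq_zero (Finset.mem_univ i) (by simp)
        have hSi : S.eval (p i) = r i * ∏ j ∈ Finset.univ.erase i, (p i - p j) := by
          rw [hSdef, eval_finsetSum, Finset.sum_eq_single i]
          · simp [eval_prod]
          · intro j _ hj
            rw [eval_mul, eval_prod, Finset.prod_eq_zero (i := i) (by simp [hj.symm]) (by simp),
              mul_zero]
          · simp
        rw [eval_mul, eval_mul, hPi, mul_zero, hSi] at h1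
        refine (mul_eq_zero.1 h1.symm).resolve_left (mul_ne_zero (hr i).ne' ?_)
        refine Finset.prod_ne_zero_iff.2 fun j hj => sub_ne_zero.2 (hp.injective.ne ?_)
        exact (Finset.ne_of_mem_erase hj).symm

/-! ### Stable realizations -/

/-- Gelfand's formula bounds `‖a ^ n‖` eventually by a convergent geometric series. -/
theorem summable_norm_pow_of_spectralRadius_lt_one {R : Type*} [NormedRing R] [NormedAlgebra ℂ R]
    [CompleteSpace R] (a : R) (h : spectralRadius ℂ a < 1) : Summable fun n => ‖a ^ n‖ := by
  obtain ⟨r, hr, hr1⟩ := ENNReal.lt_iff_exists_nnreal_btwn.1 h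
  have hr1' : (r : ℝ) < 1 := by exact_mod_cast hr1
  refine Summable.of_norm_bounded_eventually_nat (g := fun n => (r : ℝ) ^ n)
    (summable_geometric_of_lt_one r.2 hr1') ?_
  filter_upwards [(spectrum.pow_norm_pow_one_div_tendsto_nhds_spectralRadius a).eventually_lt_const
    hr, eventually_ge_atTop 1] with n hn hn1
  have h1 : ‖a ^ n‖ ^ (1 / n : ℝ) < r := by
    rwa [ENNReal.ofReal_lt_coe_iff (by positivity)] at hn
  rw [one_div] at h1
  have h2 := pow_le_pow_left₀ (by positivity) h1.le n
  rwa [Real.rpow_inv_natCast_pow (norm_nonneg _) (by omega), ← norm_norm] at h2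

open scoped Matrix.Norms.Operator in
theorem IsStable.summable_norm_pow_mulVec {n : ℕ} {A : Matrix (Fin n) (Fin n) ℝ} (hA : IsStable A)
    (b : Fin n → ℝ) : Summable fun s => ‖(A ^ s) *ᵥ b‖ := by
  -- The bound on the spectral radius below needs a nontrivial matrix ring, which excludes `n = 0`.
  rcases Nat.eq_zero_or_pos n with rfl | hn
  · refine summable_zero.congr fun s => ?_
    rw [Subsingleton.elim ((A ^ s) *ᵥ b) 0, norm_zero]
  have : Nonempty (Fin n) := ⟨⟨0, hn⟩⟩
  set B : Matrix (Fin n) (Fin n) ℂ := A.map (algebraMap ℝ ℂ) with hB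
  have hρ : spectralRadius ℂ B < (1 : NNReal) := by
    refine spectrum.spectralRadius_lt_of_forall_lt B fun z hz => ?_
    have h1 : ‖z‖ < 1 := by
      refine hA z ?_
      rw [Matrix.mem_spectrum_iff_isRoot_charpoly, hB, Matrix.charpoly_map] at hz
      rw [eigenvalues, aroots_def, mem_roots (A.charpoly_monic.map _).ne_zero]
      exact hz
    exact_mod_cast h1
  have hsum := summable_norm_pow_of_spectralRadius_lt_one B (by simpa using hρ)
  refine Summable.of_nonneg_of_le (fun s => norm_nonneg _) (fun s => ?_)
    (hsum.mul_right ‖fun i => (algebraMap ℝ ℂ) (b i)‖)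
  refine le_trans ?_ (Matrix.linfty_opNorm_mulVec (B ^ s) _)
  refine (pi_norm_le_iff_of_nonneg (norm_nonneg _)).2 fun i => ?_
  refine le_trans (le_of_eq ?_) (norm_le_pi_norm _ i)
  have h1 := RingHom.map_mulVec (algebraMap ℝ ℂ) (A ^ s) b i
  have h2 : (A ^ s).map (algebraMap ℝ ℂ) = B ^ s :=
    map_pow (algebraMap ℝ ℂ).mapMatrix A s
  rw [h2] at h1
  change _ = ‖(B ^ s *ᵥ (algebraMap ℝ ℂ ∘ b)) i‖
  rw [← h1, norm_algebraMap']

theorem IsStable.hasSum_controllabilityOp {n : ℕ} {A : Matrix (Fin n) (Fin n) ℝ} (hA : IsStable A)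
    (b : Fin n → ℝ) {u : ℕ → ℝ} (hu : u ∈ boundedSeq) :
    HasSum (fun s => u s • ((A ^ s) *ᵥ b)) (controllabilityOp A b u) := by
  obtain ⟨M, hM⟩ := hu
  refine (Summable.of_norm_bounded ((hA.summable_norm_pow_mulVec b).mul_left M)
    fun s => ?_).hasSum
  rw [norm_smul, Real.norm_eq_abs]
  exact mul_le_mul_of_nonneg_right (hM s) (norm_nonneg _)

theorem impulseResponse_zero {n : ℕ} (A : Matrix (Fin n) (Fin n) ℝ) (b c : Fin n → ℝ) :
    impulseResponse A b c 0 = 0 := by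
  rw [impulseResponse, state, dotProduct_zero]

theorem impulseResponse_succ {n : ℕ} (A : Matrix (Fin n) (Fin n) ℝ) (b c : Fin n → ℝ) (t : ℕ) :
    impulseResponse A b c (t + 1) = c ⬝ᵥ ((A ^ t) *ᵥ b) := by
  rw [impulseResponse]
  congr 1
  induction t with
  | zero => simp [state]
  | succ t ih =>
    rw [state, ih, Pi.single_eq_of_ne (Nat.succ_ne_zero t), zero_smul, add_zero,
      Matrix.mulVec_mulVec, ← pow_succ']

theorem IsRealization.hankelOp_eq {g : ℕ → ℝ} {n : ℕ} {A : Matrix (Fin n) (Fin n) ℝ}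
    {b c : Fin n → ℝ} (h : IsRealization g A b c) {u : ℕ → ℝ} (hu : u ∈ boundedSeq) :
    hankelOp g u = observabilityOp A c (controllabilityOp A b u) := by
  obtain ⟨hA, rfl⟩ := h
  funext t
  let φ : (Fin n → ℝ) →ₗ[ℝ] ℝ := (dotProductBilin ℝ ℝ c).comp (A ^ t).mulVecLin
  have hφ : Continuous φ := φ.continuous_of_finiteDimensional
  have h1 := (hA.hasSum_controllabilityOp b hu).map φ hφ
  refine Eq.trans ?_ h1.tsum_eq
  refine tsum_congr fun s => ?_
  change _ = c ⬝ᵥ ((A ^ t) *ᵥ (u s • ((A ^ s) *ᵥ b)))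
  rw [← add_assoc, impulseResponse_succ, Matrix.mulVec_smul, dotProduct_smul, Matrix.mulVec_mulVec,
    ← pow_add, smul_eq_mul, mul_comm]

theorem IsRealization.isHankelTotallyPositive {g : ℕ → ℝ} {n : ℕ} {A : Matrix (Fin n) (Fin n) ℝ}
    {b c : Fin n → ℝ} (h : IsRealization g A b c) (hI : IsInternallyHankelTotallyPositive A b c) :
    IsHankelTotallyPositive g := by
  intro k hk u hu
  obtain ⟨-, hC, hO⟩ := hI k hk
  have h0 : observabilityOp A c 0 = 0 := by
    funext t
    rw [observabilityOp, Matrix.mulVec_zero, dotProduct_zero, Pi.zero_apply]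
  rw [h.hankelOp_eq hu]
  exact hC.comp hO h0 u hu

/-! ### The diagonal realization -/

section Diagonal

variable {n : ℕ} {p r : Fin n → ℝ}

theorem diagonal_pow_mulVec (p x : Fin n → ℝ) (t : ℕ) (i : Fin n) :
    ((Matrix.diagonal p ^ t) *ᵥ x) i = p i ^ t * x i := by
  rw [Matrix.diagonal_pow, Matrix.mulVec_diagonal, Pi.pow_apply]

theorem isStable_diagonal (hp0 : ∀ i, 0 ≤ p i) (hp1 : ∀ i, p i < 1) :
    IsStable (Matrix.diagonal p) := by
  intro μ hμ
  rw [eigenvalues, mem_aroots, Matrix.charpoly_diagonal, map_prod, Finset.prod_eq_zero_iff] at hμ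
  obtain ⟨-, i, -, hi⟩ := hμ
  rw [map_sub, aeval_X, aeval_C, sub_eq_zero] at hi
  rw [hi, norm_algebraMap', Real.norm_of_nonneg (hp0 i)]
  exact hp1 i

theorem isRealization_diagonal {g : ℕ → ℝ} (hg0 : g 0 = 0)
    (hg : ∀ t, g (t + 1) = ∑ i, r i * p i ^ t) (hp0 : ∀ i, 0 ≤ p i) (hp1 : ∀ i, p i < 1)
    (hr : ∀ i, 0 < r i) :
    IsRealization g (Matrix.diagonal p) (fun i => √(r i)) (fun i => √(r i)) := by
  refine ⟨isStable_diagonal hp0 hp1, funext fun t => ?_⟩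
  cases t with
  | zero => rw [impulseResponse_zero, hg0]
  | succ t =>
    rw [impulseResponse_succ, hg]
    simp only [dotProduct, diagonal_pow_mulVec]
    refine Finset.sum_congr rfl fun i _ => ?_
    linear_combination p i ^ t * Real.mul_self_sqrt (hr i).le

theorem isInternallyHankelTotallyPositive_diagonal (hp : StrictMono p) (hp0 : ∀ i, 0 ≤ p i)
    (hp1 : ∀ i, p i < 1) {b c : Fin n → ℝ} (hb : ∀ i, 0 < b i) (hc : ∀ i, 0 < c i) :
    IsInternallyHankelTotallyPositive (Matrix.diagonal p) b c := by
  have hsign : ∀ {a x : ℝ}, 0 ≤ a → a * x ≠ 0 → 0 < a * x * x := fun ha h0 => by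
    have h1 := lt_of_le_of_ne ha (left_ne_zero_of_mul h0).symm
    rw [mul_assoc]
    exact mul_pos h1 (mul_self_pos.2 (right_ne_zero_of_mul h0))
  intro k _
  refine ⟨isOVD_of_altFrom _ fun x _ m σ j h => ?_, isOVD_of_altFrom _ fun u hu m σ j h => ?_,
    isOVD_of_altFrom _ fun x _ m σ j h => ?_⟩
  · refine ⟨j, h.congr_sign fun i _ h0 => ?_⟩
    rw [Matrix.mulVec_diagonal] at h0 ⊢
    exact hsign (hp0 i) h0
  · have hC : ∀ i, controllabilityOp (Matrix.diagonal p) b u i =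
        b i * ∑' s, u s * p i ^ s := by
      intro i
      have h1 := Pi.hasSum.1 ((isStable_diagonal hp0 hp1).hasSum_controllabilityOp b hu) i
      rw [← h1.tsum_eq, ← tsum_mul_left]
      refine tsum_congr fun s => ?_
      rw [Pi.smul_apply, diagonal_pow_mulVec, smul_eq_mul]
      ring
    have h2 : AltFrom (fun i => ∑' s, u s * p i ^ s) m σ j := by
      refine h.congr_sign fun i _ h0 => ?_
      rw [hC] at h0 ⊢
      exact hsign (hb i).le h0
    exact altFrom_of_powerSum hp hp0 hp1 hu h2
  · have hO : observabilityOp (Matrix.diagonal p) c x = fun t => ∑ i, (c i * x i) * p i ^ t := by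
      funext t
      simp only [observabilityOp, dotProduct, diagonal_pow_mulVec]
      exact Finset.sum_congr rfl fun i _ => by ring
    rw [hO] at h
    obtain ⟨i, hi⟩ := altFrom_of_expSum hp hp0 _ h
    exact ⟨i, hi.congr_sign fun i _ h0 => hsign (hc i).le h0⟩

end Diagonal

theorem IsHankelTotallyPositive.exists_expSum {g : ℕ → ℝ} (hH : IsHankelTotallyPositive g)
    (hg : Summable g) (hg0 : g 0 = 0) {G : RatFunc ℝ} (hG : IsTransferFunction g G) :
    ∃ (n : ℕ) (p r : Fin n → ℝ), StrictMono p ∧ (∀ i, 0 ≤ p i) ∧ (∀ i, p i < 1) ∧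
      (∀ i, 0 < r i) ∧ ∀ t, g (t + 1) = ∑ i, r i * p i ^ t := by
  obtain ⟨s, r, hsr, hL⟩ := exists_atoms (L := momentFunctional fun t => g (t + 1))
    (fun q => by simpa using hH.momentFunctional_nonneg 0 q)
    (fun q => by simpa using hH.momentFunctional_nonneg 1 q)
    (fun h0 => G.denom_ne_zero (by simpa [h0] using hG.denom_mem hg hg0))
  -- Since `0 ^ 0 = 1`, an atom at `0` contributes to `g 1` only.
  have hmom : ∀ t, g (t + 1) = ∑ x ∈ s, r x * x ^ t := fun t => by
    have h1 := hL (X ^ t)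
    rw [momentFunctional_X_pow] at h1
    simpa using h1
  -- All terms are nonnegative, so each `r x * x ^ t` is dominated by the summable `g (t + 1)`.
  have hlt : ∀ x ∈ s, x < 1 := by
    intro x hx
    obtain ⟨hx0, hrx⟩ := hsr x hx
    have h1 : Summable fun t => r x * x ^ t := by
      refine Summable.of_nonneg_of_le (fun t => by positivity) (fun t => ?_)
        ((summable_nat_add_iff 1).2 hg)
      rw [hmom t]
      exact Finset.single_le_sum (f := fun y => r y * y ^ t)
        (fun y hy => mul_nonneg (hsr y hy).2.le (pow_nonneg (hsr y hy).1 t)) hx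
    have h2 := (summable_mul_left_iff hrx.ne').1 h1
    rwa [summable_geometric_iff_norm_lt_one, Real.norm_of_nonneg hx0] at h2
  refine ⟨s.card, fun i => s.orderEmbOfFin rfl i, fun i => r (s.orderEmbOfFin rfl i),
    (s.orderEmbOfFin rfl).strictMono, fun i => (hsr _ (s.orderEmbOfFin_mem rfl i)).1,
    fun i => hlt _ (s.orderEmbOfFin_mem rfl i), fun i => (hsr _ (s.orderEmbOfFin_mem rfl i)).2,
    fun t => ?_⟩
  rw [hmom t]
  conv_lhs => rw [← Finset.image_orderEmbOfFin_univ s rfl]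
  rw [Finset.sum_image fun _ _ _ _ h => (s.orderEmbOfFin rfl).injective h]

end HankelTP

end

theorem mainTheorem4 (g : ℕ → ℝ) (hg : Summable (fun t => |g t|)) (hg0 : g 0 = 0)
    (G : RatFunc ℝ) (hG : HankelTP.IsTransferFunction g G) :
    (HankelTP.IsHankelTotallyPositive g ↔
      ∃ (n : ℕ) (A : Matrix (Fin n) (Fin n) ℝ) (b c : Fin n → ℝ),
        HankelTP.IsMinimalRealization g G A b c ∧
        HankelTP.IsInternallyHankelTotallyPositive A b c) ∧
    (HankelTP.IsHankelTotallyPositive g →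
      ∃ (n : ℕ) (p r : Fin n → ℝ),
        StrictMono p ∧ (∀ i, 0 ≤ p i) ∧ (∀ i, 0 < r i) ∧
        G = ∑ i, RatFunc.C (r i) / (RatFunc.X - RatFunc.C (p i)) ∧
        HankelTP.IsMinimalRealization g G (Matrix.diagonal p)
          (fun i => Real.sqrt (r i)) (fun i => Real.sqrt (r i)) ∧
        HankelTP.IsInternallyHankelTotallyPositive (Matrix.diagonal p)
          (fun i => Real.sqrt (r i)) (fun i => Real.sqrt (r i))) := by
  have hmain : HankelTP.IsHankelTotallyPositive g →
      ∃ (n : ℕ) (p r : Fin n → ℝ),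
        StrictMono p ∧ (∀ i, 0 ≤ p i) ∧ (∀ i, 0 < r i) ∧
        G = ∑ i, RatFunc.C (r i) / (RatFunc.X - RatFunc.C (p i)) ∧
        HankelTP.IsMinimalRealization g G (Matrix.diagonal p)
          (fun i => Real.sqrt (r i)) (fun i => Real.sqrt (r i)) ∧
        HankelTP.IsInternallyHankelTotallyPositive (Matrix.diagonal p)
          (fun i => Real.sqrt (r i)) (fun i => Real.sqrt (r i)) := by
    intro hH
    obtain ⟨n, p, r, hp, hp0, hp1, hr, hgt⟩ := hH.exists_expSum (summable_abs_iff.1 hg) hg0 hG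
    obtain ⟨hsum, hdenom⟩ := HankelTP.eq_sum_and_denom_eq hp hp1 hr fun z hz => by
      rw [hG.num_eval hg0 hz, ← HankelTP.delayedTransform_expSum hp0 hp1 hz]
      simp only [hgt]
    refine ⟨n, p, r, hp, hp0, hr, hsum,
      ⟨HankelTP.isRealization_diagonal hg0 hgt hp0 hp1 hr, ?_⟩,
      HankelTP.isInternallyHankelTotallyPositive_diagonal hp hp0 hp1
        (fun i => Real.sqrt_pos.2 (hr i)) (fun i => Real.sqrt_pos.2 (hr i))⟩
    rw [HankelTP.eigenvalues, HankelTP.poles, hdenom, Matrix.charpoly_diagonal]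
  refine ⟨⟨fun hH => ?_, ?_⟩, hmain⟩
  · obtain ⟨n, p, r, -, -, -, -, hmin, hint⟩ := hmain hH
    exact ⟨n, _, _, _, hmin, hint⟩
  · rintro ⟨n, A, b, c, hmin, hint⟩
    exact hmin.1.isHankelTotallyPositive hint
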